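/- Work in the category of complex algebraic varieties (Zariski topology, regular mappings). Let $n\ge 0$ and let $f,g\in\mathcal{O}_{\mathbb{C}^n,0}$ be germs of regular functions at the origin of $\mathbb{C}^n$. Assume that $f(0)=0$, that the derivative of $f$ at $0$ is nonzero, and that $f$ does not divide $g$ in the ring $\mathcal{O}_{\mathbb{C}^n,0}$. Let $U\subset\mathbb{C}^n$ be any Zariski open neighbourhood of $0$ on which $f$ and $g$ are represented by regular functions, denoted again by $f$ and $g$, and let the local blowup $\mathrm{Bl}(f,g)$ be the Zariski closure in $U\times\mathbb{P}^1_{\mathbb{C}}$ of the set \[ \{(x,(f(x):g(x)))\;:\;x\in U,\ (f(x),g(x))\neq(0,0)\}. \] Then $(0,(0:1))\in\mathrm{Bl}(f,g)$, and the germ $(\mathrm{Bl}(f,g),(0,(0:1)))$ is isomorphic to the germ $(\mathbb{C}^n,0)$; that is, some Zariski open neighbourhood of $(0,(0:1))$ in $\mathrm{Bl}(f,g)$ is biregularly isomorphic to a Zariski open neighbourhood of $0$ in $\mathbb{C}^n$, by an isomorphism taking $(0,(0:1))$ to $0$. -/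

import Mathlib

open scoped LinearAlgebra.Projectivization Topology
open Filter

/-! ## Classical varieties: Zariski topology and regular functions

A class of ambient spaces `X` (here `ℂⁿ` and `ℂⁿ × ℙ¹`) is described by its fractions: the pairs
`(p, q)` of a numerator and a denominator whose quotient is a well-defined function on `q ≠ 0`. -/

/-- The pairs (numerator, denominator) of functions on `X` out of which the regular functions on
subsets of `X` are built. -/
class HasFractions (X : Type) where
  fractions : Set ((X → ℂ) × (X → ℂ))

/-- On `ℂⁿ`: all pairs of polynomial functions. -/
instance affineFractions (n : ℕ) : HasFractions (Fin n → ℂ) where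
  fractions := {φ | ∃ P Q : MvPolynomial (Fin n) ℂ,
    φ = (fun x => MvPolynomial.eval x P, fun x => MvPolynomial.eval x Q)}

/-- The projective line `ℙ¹` over `ℂ`; the class of `![s, t]` is the point `(s : t)`. -/
abbrev ProjLine : Type := ℙ ℂ (Fin 2 → ℂ)

/-- On `ℂⁿ × ℙ¹`: all pairs of polynomials in the affine coordinates and the two homogeneous
coordinates, both homogeneous of the same degree `d` in the homogeneous coordinates. Neither the
non-vanishing of the denominator nor the value of the quotient depends on the representative
`y.2.rep` of the point of `ℙ¹`. -/
instance affineProjLineFractions (n : ℕ) : HasFractions ((Fin n → ℂ) × ProjLine) where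
  fractions := {φ | ∃ (d : ℕ) (P Q : MvPolynomial (Fin n ⊕ Fin 2) ℂ),
    P.IsWeightedHomogeneous (Sum.elim (fun _ => 0) (fun _ => 1) : Fin n ⊕ Fin 2 → ℕ) d ∧
    Q.IsWeightedHomogeneous (Sum.elim (fun _ => 0) (fun _ => 1) : Fin n ⊕ Fin 2 → ℕ) d ∧
    φ = (fun y => MvPolynomial.eval (Sum.elim y.1 y.2.rep) P,
         fun y => MvPolynomial.eval (Sum.elim y.1 y.2.rep) Q)}

/-- The Zariski topology: generated by the non-vanishing sets of the denominators, that is, of all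
polynomials on `ℂⁿ`, and of all polynomials homogeneous in the homogeneous coordinates on
`ℂⁿ × ℙ¹`. It is not an instance, as `ℂⁿ` already carries its Euclidean topology. -/
abbrev zariski (X : Type) [HasFractions X] : TopologicalSpace X :=
  TopologicalSpace.generateFrom {D | ∃ φ ∈ HasFractions.fractions (X := X), D = {x | φ.2 x ≠ 0}}

/-- The restriction to `S ⊆ X` of the complex-valued function `h` is regular at `a`: on a Zariski
neighbourhood of `a` in `S` it is a fraction. Values of `h` outside `S` play no role. -/
def RegularAt {X : Type} [HasFractions X] (S : Set X) (h : X → ℂ) (a : X) : Prop :=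
  ∃ φ ∈ HasFractions.fractions (X := X), φ.2 a ≠ 0 ∧ ∃ W : Set X, IsOpen[zariski X] W ∧ a ∈ W ∧
    ∀ x ∈ S ∩ W, φ.2 x ≠ 0 ∧ h x = φ.1 x / φ.2 x

/-- `h` restricts to a regular function on `S`. -/
def RegularOn {X : Type} [HasFractions X] (S : Set X) (h : X → ℂ) : Prop :=
  ∀ a ∈ S, RegularAt S h a

/-- `m` restricts to a regular mapping `S → T`: it is continuous for the Zariski topologies and
pulls regular functions back to regular functions. -/
def RegularMap {X Y : Type} [HasFractions X] [HasFractions Y] (S : Set X) (T : Set Y)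
    (m : X → Y) : Prop :=
  Set.MapsTo m S T ∧ @ContinuousOn X Y (zariski X) (zariski Y) m S ∧
    ∀ a ∈ S, ∀ h : Y → ℂ, RegularAt T h (m a) → RegularAt S (h ∘ m) a

/-- The germs `(S, a)` and `(T, b)` are isomorphic: `a ∈ S`, `b ∈ T`, and there are Zariski open
neighbourhoods of `a` in `S` and of `b` in `T` with mutually inverse regular mappings between them
that exchange `a` and `b`. -/
def GermIso {X Y : Type} [HasFractions X] [HasFractions Y] (S : Set X) (a : X) (T : Set Y)
    (b : Y) : Prop :=
  a ∈ S ∧ b ∈ T ∧ ∃ (V : Set X) (W : Set Y) (m : X → Y) (k : Y → X),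
    IsOpen[zariski X] V ∧ a ∈ V ∧ IsOpen[zariski Y] W ∧ b ∈ W ∧
    RegularMap (S ∩ V) (T ∩ W) m ∧ RegularMap (T ∩ W) (S ∩ V) k ∧
    (∀ x ∈ S ∩ V, k (m x) = x) ∧ (∀ y ∈ T ∩ W, m (k y) = y) ∧ m a = b ∧ k b = a

/-! ## The ring of germs of regular functions at the origin of `ℂⁿ` -/

/-- The filter of Zariski neighbourhoods of `0 ∈ ℂⁿ`. -/
def zariskiNhds (n : ℕ) : Filter (Fin n → ℂ) := @nhds _ (zariski (Fin n → ℂ)) 0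

theorem eventually_zariskiNhds {n : ℕ} {p : (Fin n → ℂ) → Prop} :
    (∀ᶠ x in zariskiNhds n, p x) ↔
      ∃ W : Set (Fin n → ℂ), (∀ x ∈ W, p x) ∧ IsOpen[zariski _] W ∧ (0 : Fin n → ℂ) ∈ W :=
  @eventually_nhds_iff _ (zariski (Fin n → ℂ)) _ _

theorem nhds_le_zariskiNhds (n : ℕ) : 𝓝 (0 : Fin n → ℂ) ≤ zariskiNhds n := by
  apply _root_.nhds_mono
  apply le_generateFrom
  rintro D ⟨φ, ⟨P, Q, rfl⟩, rfl⟩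
  exact isOpen_ne_fun (MvPolynomial.continuous_eval Q) continuous_const

theorem regularAt_zero_iff {n : ℕ} {h : (Fin n → ℂ) → ℂ} :
    RegularAt Set.univ h 0 ↔ ∃ P Q : MvPolynomial (Fin n) ℂ, MvPolynomial.eval 0 Q ≠ 0 ∧
      ∀ᶠ x in zariskiNhds n, MvPolynomial.eval x Q ≠ 0 ∧
        h x = MvPolynomial.eval x P / MvPolynomial.eval x Q := by
  simp only [eventually_zariskiNhds]
  constructor
  · rintro ⟨_, ⟨P, Q, rfl⟩, h0, W, hW, h0W, H⟩
    exact ⟨P, Q, h0, W, fun x hx => H x ⟨trivial, hx⟩, hW, h0W⟩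
  · rintro ⟨P, Q, h0, W, H, hW, h0W⟩
    exact ⟨_, ⟨P, Q, rfl⟩, h0, W, hW, h0W, fun x hx => H x hx.2⟩

/-- The ring `𝒪_{ℂⁿ,0}` of germs at `0`, for the Zariski topology, of complex-valued functions
regular at `0`. -/
def regularGerms (n : ℕ) : Subring (Germ (zariskiNhds n) ℂ) where
  carrier := {γ | ∃ h : (Fin n → ℂ) → ℂ, RegularAt Set.univ h 0 ∧ (h : Germ (zariskiNhds n) ℂ) = γ}
  zero_mem' := ⟨0, regularAt_zero_iff.2 ⟨0, 1, by simp, by simp⟩, rfl⟩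
  one_mem' := ⟨1, regularAt_zero_iff.2 ⟨1, 1, by simp, by simp⟩, rfl⟩
  add_mem' := by
    rintro _ _ ⟨h, hh, rfl⟩ ⟨k, hk, rfl⟩
    obtain ⟨P, Q, hQ, H⟩ := regularAt_zero_iff.1 hh
    obtain ⟨P', Q', hQ', H'⟩ := regularAt_zero_iff.1 hk
    refine ⟨h + k, regularAt_zero_iff.2 ⟨P * Q' + Q * P', Q * Q', by simpa only [map_mul] using mul_ne_zero hQ hQ', ?_⟩, rfl⟩
    filter_upwards [H, H'] with x hx hx'
    refine ⟨by simp [hx.1, hx'.1], ?_⟩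
    simp only [Pi.add_apply, hx.2, hx'.2, map_add, map_mul]
    exact div_add_div _ _ hx.1 hx'.1
  mul_mem' := by
    rintro _ _ ⟨h, hh, rfl⟩ ⟨k, hk, rfl⟩
    obtain ⟨P, Q, hQ, H⟩ := regularAt_zero_iff.1 hh
    obtain ⟨P', Q', hQ', H'⟩ := regularAt_zero_iff.1 hk
    refine ⟨h * k, regularAt_zero_iff.2 ⟨P * P', Q * Q', by simpa only [map_mul] using mul_ne_zero hQ hQ', ?_⟩, rfl⟩
    filter_upwards [H, H'] with x hx hx'
    refine ⟨by simp [hx.1, hx'.1], ?_⟩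
    simp only [Pi.mul_apply, hx.2, hx'.2, map_mul]
    exact div_mul_div_comm _ _ _ _
  neg_mem' := by
    rintro _ ⟨h, hh, rfl⟩
    obtain ⟨P, Q, hQ, H⟩ := regularAt_zero_iff.1 hh
    refine ⟨-h, regularAt_zero_iff.2 ⟨-P, Q, hQ, ?_⟩, rfl⟩
    filter_upwards [H] with x hx
    refine ⟨hx.1, ?_⟩
    simp only [Pi.neg_apply, hx.2, map_neg, neg_div]

/-- The value of a germ at `0`. -/
def germValue {n : ℕ} (γ : Germ (zariskiNhds n) ℂ) : ℂ :=
  Quotient.liftOn' γ (fun h => h 0) fun _ _ hk =>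
    ((show _ =ᶠ[zariskiNhds n] _ from hk).filter_mono (nhds_le_zariskiNhds n)).eq_of_nhds

/-- The complex derivative of a germ at `0`, a linear form on `ℂⁿ`. -/
noncomputable def germDeriv {n : ℕ} (γ : Germ (zariskiNhds n) ℂ) : (Fin n → ℂ) →L[ℂ] ℂ :=
  Quotient.liftOn' γ (fun h => fderiv ℂ h 0) fun _ _ hk =>
    ((show _ =ᶠ[zariskiNhds n] _ from hk).filter_mono (nhds_le_zariskiNhds n)).fderiv_eq

/-! ## The local blowup -/

/-- The point `(0 : 1)` of `ℙ¹`. -/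
noncomputable def zeroOne : ProjLine := Projectivization.mk ℂ ![0, 1] (by simp)

/-- The graph `{(x, (F x : G x))}` over the points of `U` at which `F` and `G` do not both
vanish. -/
def ratioGraph {n : ℕ} (U : Set (Fin n → ℂ)) (F G : (Fin n → ℂ) → ℂ) :
    Set ((Fin n → ℂ) × ProjLine) :=
  {y | y.1 ∈ U ∧ ∃ h : ![F y.1, G y.1] ≠ 0, y.2 = Projectivization.mk ℂ ![F y.1, G y.1] h}

/-- The local blowup of `U ⊆ ℂⁿ` in `(F, G)`: the Zariski closure of the graph in `U × ℙ¹`. -/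
def localBlowup {n : ℕ} (U : Set (Fin n → ℂ)) (F G : (Fin n → ℂ) → ℂ) :
    Set ((Fin n → ℂ) × ProjLine) :=
  {y | y.1 ∈ U} ∩ closure[zariski _] (ratioGraph U F G)

/-!
Locally `f` is a unit times a prime polynomial `p` with nonzero derivative at `0`, and `g` a unit
times a polynomial `h`; rescaling by units does not affect the question, and `p` does not divide
`h`. Near `(0, (0 : 1))` the blowup is contained in the hypersurface `f(x) = s g(x)`, which is smooth
there. A smooth point need not have a Zariski neighbourhood isomorphic to an open subset of affine
space, so the chart has to be found by hand. This is trivial if `g(0) ≠ 0`.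

Otherwise the point is to replace the local generators of the ideal `(f, g)` by simpler ones. As `p`
is prime and does not divide `h`, the ideal `(p, h)` contains a nonzero homogeneous polynomial `D`
(`exists_isHomogeneous_mem_span_pair`). A vector `v` with `D(v) ≠ 0` and `dp(v) ≠ 0` spans a line
that meets the common zero set of `p` and `h` only in the origin, and transversally. On the family
of lines `y + ℂ v` the common zero set is therefore finite over the parameter space, with reduced
one-point fibre over `y = 0`, and Nakayama's lemma shows that it lies in a graph
(`exists_linear_mem_span_pair`): if `ℓ` is a linear form with `ℓ(v) = 1`, then `(f, g)` contains
`ℓ - α` locally, for a regular function `α` that is constant along `v`.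

Restricted to the graph `ℓ = α`, one of `f`, `g` is a multiple of the other, since the coefficients
of `ℓ - α = a f + b g` do not both vanish at `0`. Subtracting a multiple of `f` from `g` one may
assume that the derivative of `g` along `v` vanishes, whence `a(0) ≠ 0`, and the ideal becomes
`(ℓ - α, R)`, where `R` is the restriction of `g` to the graph, extended to be constant along `v`.
It is not zero because `f` does not divide `g`. The blowup of `(ℓ - α, R)` has the chart
`ℓ = α + t R`, with coordinate `t` in place of `ℓ`, which is an open subset of affine space. The
explicit formulas and their inverses are in `germIso_localBlowup_of_elimination`. They are mutually
inverse where `R ≠ 0`, hence everywhere by density (`germIso_of_chart`).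
-/

/-! ### Regular functions and regular mappings -/

/-- The filter of Zariski neighbourhoods of `a` in `S`. -/
def zariskiNhdsWithin {X : Type} [HasFractions X] (S : Set X) (a : X) : Filter X :=
  @nhdsWithin X (zariski X) a S

/-- The fractions on `X` contain the constants and are closed under sums, products and
inversion. -/
class FractionLaws (X : Type) [HasFractions X] : Prop where
  const_mem (c : ℂ) : ((fun _ => c, fun _ => 1) : (X → ℂ) × (X → ℂ)) ∈ HasFractions.fractions
  add_mem {φ ψ : (X → ℂ) × (X → ℂ)} (hφ : φ ∈ HasFractions.fractions)
    (hψ : ψ ∈ HasFractions.fractions) :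
    (φ.1 * ψ.2 + φ.2 * ψ.1, φ.2 * ψ.2) ∈ HasFractions.fractions
  mul_mem {φ ψ : (X → ℂ) × (X → ℂ)} (hφ : φ ∈ HasFractions.fractions)
    (hψ : ψ ∈ HasFractions.fractions) : (φ.1 * ψ.1, φ.2 * ψ.2) ∈ HasFractions.fractions
  swap_mem {φ : (X → ℂ) × (X → ℂ)} (hφ : φ ∈ HasFractions.fractions) :
    φ.swap ∈ HasFractions.fractions

instance (n : ℕ) : FractionLaws (Fin n → ℂ) where
  const_mem c := ⟨MvPolynomial.C c, 1, by simp⟩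
  add_mem := by
    rintro _ _ ⟨P, Q, rfl⟩ ⟨P', Q', rfl⟩
    exact ⟨P * Q' + Q * P', Q * Q', by ext <;> simp⟩
  mul_mem := by
    rintro _ _ ⟨P, Q, rfl⟩ ⟨P', Q', rfl⟩
    exact ⟨P * P', Q * Q', by ext <;> simp⟩
  swap_mem := by
    rintro _ ⟨P, Q, rfl⟩
    exact ⟨Q, P, rfl⟩

instance (n : ℕ) : FractionLaws ((Fin n → ℂ) × ProjLine) where
  const_mem c := ⟨0, MvPolynomial.C c, 1, MvPolynomial.isWeightedHomogeneous_C _ _,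
    MvPolynomial.isWeightedHomogeneous_one _ _, by simp⟩
  add_mem := by
    rintro _ _ ⟨d, P, Q, hP, hQ, rfl⟩ ⟨d', P', Q', hP', hQ', rfl⟩
    exact ⟨d + d', P * Q' + Q * P', Q * Q', (hP.mul hQ').add (hQ.mul hP'), hQ.mul hQ', by
      ext <;> simp⟩
  mul_mem := by
    rintro _ _ ⟨d, P, Q, hP, hQ, rfl⟩ ⟨d', P', Q', hP', hQ', rfl⟩
    exact ⟨d + d', P * P', Q * Q', hP.mul hP', hQ.mul hQ', by ext <;> simp⟩
  swap_mem := by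
    rintro _ ⟨d, P, Q, hP, hQ, rfl⟩
    exact ⟨d, Q, P, hQ, hP, rfl⟩

section Regular

variable {X : Type} [HasFractions X] {S : Set X} {a : X}

theorem zariskiNhds_eq_within (n : ℕ) :
    zariskiNhds n = zariskiNhdsWithin Set.univ (0 : Fin n → ℂ) :=
  (@nhdsWithin_univ _ (zariski _) _).symm

theorem mem_zariskiNhdsWithin {s : Set X} :
    s ∈ zariskiNhdsWithin S a ↔ ∃ u, IsOpen[zariski X] u ∧ a ∈ u ∧ u ∩ S ⊆ s :=
  @mem_nhdsWithin X (zariski X) _ _ _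

theorem zariskiNhdsWithin_mono {T : Set X} (h : S ⊆ T) (a : X) :
    zariskiNhdsWithin S a ≤ zariskiNhdsWithin T a :=
  @nhdsWithin_mono X (zariski X) a _ _ h

theorem eventually_zariskiNhdsWithin_mem : ∀ᶠ x in zariskiNhdsWithin S a, x ∈ S :=
  @eventually_mem_nhdsWithin X (zariski X) a S

theorem Filter.Eventually.self_of_zariskiNhdsWithin {p : X → Prop}
    (h : ∀ᶠ x in zariskiNhdsWithin S a, p x) (ha : a ∈ S) : p a :=
  @Eventually.self_of_nhdsWithin X (zariski X) _ _ _ h ha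

theorem eventually_fraction_ne_zero {φ : (X → ℂ) × (X → ℂ)} (hφ : φ ∈ HasFractions.fractions)
    (ha : φ.2 a ≠ 0) : ∀ᶠ x in zariskiNhdsWithin S a, φ.2 x ≠ 0 :=
  mem_zariskiNhdsWithin.2
    ⟨_, TopologicalSpace.isOpen_generateFrom_of_mem ⟨φ, hφ, rfl⟩, ha, fun _ hx => hx.1⟩

theorem regularAt_iff {h : X → ℂ} : RegularAt S h a ↔
    ∃ φ ∈ HasFractions.fractions (X := X), φ.2 a ≠ 0 ∧
      ∀ᶠ x in zariskiNhdsWithin S a, φ.2 x ≠ 0 ∧ h x = φ.1 x / φ.2 x := by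
  simp only [RegularAt, Filter.Eventually, mem_zariskiNhdsWithin]
  refine exists_congr fun φ => and_congr_right fun _ => and_congr_right fun _ =>
    exists_congr fun W => and_congr_right fun _ => and_congr_right fun _ =>
    ⟨fun H x hx => H x hx.symm, fun H x hx => H hx.symm⟩

theorem RegularAt.congr {h k : X → ℂ} (hh : RegularAt S h a)
    (hk : ∀ᶠ x in zariskiNhdsWithin S a, k x = h x) : RegularAt S k a := by
  obtain ⟨φ, hφ, h0, H⟩ := regularAt_iff.1 hh
  exact regularAt_iff.2 ⟨φ, hφ, h0, by
    filter_upwards [H, hk] with x hx hx'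
    exact ⟨hx.1, hx'.trans hx.2⟩⟩

theorem RegularAt.mono {T : Set X} {h : X → ℂ} (hh : RegularAt T h a) (hST : S ⊆ T) :
    RegularAt S h a := by
  obtain ⟨φ, hφ, h0, H⟩ := regularAt_iff.1 hh
  exact regularAt_iff.2 ⟨φ, hφ, h0, H.filter_mono (zariskiNhdsWithin_mono hST a)⟩

theorem regularAt_fraction {φ : (X → ℂ) × (X → ℂ)} (hφ : φ ∈ HasFractions.fractions)
    (ha : φ.2 a ≠ 0) : RegularAt S (fun x => φ.1 x / φ.2 x) a :=
  regularAt_iff.2 ⟨φ, hφ, ha, (eventually_fraction_ne_zero hφ ha).mono fun _ hx => ⟨hx, rfl⟩⟩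

/-- A function regular at `a` is regular at all points of a Zariski neighbourhood of `a`. -/
theorem RegularAt.eventually {h : X → ℂ} (hh : RegularAt Set.univ h a) :
    ∀ᶠ x in zariskiNhdsWithin Set.univ a, RegularAt Set.univ h x := by
  obtain ⟨φ, hφ, h0, W, hW, haW, H⟩ := hh
  exact mem_zariskiNhdsWithin.2 ⟨W, hW, haW, fun x hx =>
    ⟨φ, hφ, (H x ⟨trivial, hx.1⟩).1, W, hW, hx.1, H⟩⟩

variable [FractionLaws X]

theorem regularAt_const (c : ℂ) : RegularAt S (fun _ => c) a :=
  (regularAt_fraction (FractionLaws.const_mem c) (by simp)).congr (by simp)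

theorem RegularAt.add {h k : X → ℂ} (hh : RegularAt S h a) (hk : RegularAt S k a) :
    RegularAt S (fun x => h x + k x) a := by
  obtain ⟨φ, hφ, h0, H⟩ := regularAt_iff.1 hh
  obtain ⟨ψ, hψ, k0, K⟩ := regularAt_iff.1 hk
  refine regularAt_iff.2 ⟨_, FractionLaws.add_mem hφ hψ, mul_ne_zero h0 k0, ?_⟩
  filter_upwards [H, K] with x hx hx'
  refine ⟨mul_ne_zero hx.1 hx'.1, ?_⟩
  rw [hx.2, hx'.2]
  exact div_add_div _ _ hx.1 hx'.1

theorem RegularAt.mul {h k : X → ℂ} (hh : RegularAt S h a) (hk : RegularAt S k a) :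
    RegularAt S (fun x => h x * k x) a := by
  obtain ⟨φ, hφ, h0, H⟩ := regularAt_iff.1 hh
  obtain ⟨ψ, hψ, k0, K⟩ := regularAt_iff.1 hk
  refine regularAt_iff.2 ⟨_, FractionLaws.mul_mem hφ hψ, mul_ne_zero h0 k0, ?_⟩
  filter_upwards [H, K] with x hx hx'
  refine ⟨mul_ne_zero hx.1 hx'.1, ?_⟩
  rw [hx.2, hx'.2]
  exact div_mul_div_comm _ _ _ _

theorem RegularAt.neg {h : X → ℂ} (hh : RegularAt S h a) : RegularAt S (fun x => -h x) a :=
  ((regularAt_const (-1)).mul hh).congr (by simp)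

theorem RegularAt.sub {h k : X → ℂ} (hh : RegularAt S h a) (hk : RegularAt S k a) :
    RegularAt S (fun x => h x - k x) a :=
  (hh.add hk.neg).congr (by simp [sub_eq_add_neg])

theorem RegularAt.pow {h : X → ℂ} (hh : RegularAt S h a) (k : ℕ) :
    RegularAt S (fun x => h x ^ k) a := by
  induction k with
  | zero => simpa using regularAt_const 1
  | succ k ih => simpa only [pow_succ] using ih.mul hh

theorem RegularAt.sum {ι : Type*} (s : Finset ι) {h : ι → X → ℂ}
    (hh : ∀ i ∈ s, RegularAt S (h i) a) : RegularAt S (fun x => ∑ i ∈ s, h i x) a := by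
  classical
  induction s using Finset.induction_on with
  | empty => simpa using regularAt_const 0
  | insert i s hi ih =>
    simp only [Finset.sum_insert hi]
    exact (hh i (by simp)).add (ih fun j hj => hh j (by simp [hj]))

/-- The non-vanishing locus of a regular function is open. The numerator of a fraction is the
denominator of the inverse fraction, so its non-vanishing locus is open too. -/
theorem RegularAt.eventually_ne_zero {h : X → ℂ} (hh : RegularAt S h a) (haS : a ∈ S)
    (ha : h a ≠ 0) : ∀ᶠ x in zariskiNhdsWithin S a, h x ≠ 0 := by
  obtain ⟨φ, hφ, h0, H⟩ := regularAt_iff.1 hh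
  have h1 : φ.1 a ≠ 0 := fun h1 => ha (by
    rw [(H.self_of_zariskiNhdsWithin haS).2, h1, zero_div])
  filter_upwards [H, eventually_fraction_ne_zero (S := S) (FractionLaws.swap_mem hφ) h1]
    with x hx hx'
  rw [hx.2]
  exact div_ne_zero hx' hx.1

theorem RegularAt.div {h k : X → ℂ} (hh : RegularAt S h a) (hk : RegularAt S k a) (haS : a ∈ S)
    (ha : k a ≠ 0) : RegularAt S (fun x => h x / k x) a := by
  have hinv : RegularAt S (fun x => (k x)⁻¹) a := by
    have hne := hk.eventually_ne_zero haS ha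
    obtain ⟨φ, hφ, h0, H⟩ := regularAt_iff.1 hk
    refine regularAt_iff.2 ⟨_, FractionLaws.swap_mem hφ, fun h1 => ha ?_, ?_⟩
    · rw [(H.self_of_zariskiNhdsWithin haS).2, show φ.1 a = 0 from h1, zero_div]
    · filter_upwards [H, hne] with x hx hx'
      refine ⟨fun h1 => hx' ?_, ?_⟩
      · rw [hx.2, show φ.1 x = 0 from h1, zero_div]
      · rw [hx.2, inv_div]; rfl
  simpa only [div_eq_mul_inv] using hh.mul hinv

theorem RegularAt.eval {ι : Type*} {u : ι → X → ℂ} (hu : ∀ i, RegularAt S (u i) a)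
    (P : MvPolynomial ι ℂ) : RegularAt S (fun x => MvPolynomial.eval (fun i => u i x) P) a := by
  induction P using MvPolynomial.induction_on with
  | C c => simpa using regularAt_const c
  | add p q hp hq => simpa only [map_add] using hp.add hq
  | mul_X p i hp => simpa only [map_mul, MvPolynomial.eval_X] using hp.mul (hu i)

/-- The zero set of a regular function is closed. -/
theorem RegularAt.eq_zero_of_mem_closure {h : X → ℂ} (hh : RegularAt Set.univ h a) {V : Set X}
    (hV : IsOpen[zariski X] V) (haV : a ∈ V) (ha : a ∈ closure[zariski X] S)
    (H : ∀ x ∈ S ∩ V, h x = 0) : h a = 0 := by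
  by_contra hne
  obtain ⟨u, hu, hau, hsub⟩ := mem_zariskiNhdsWithin.1 (hh.eventually_ne_zero trivial hne)
  obtain ⟨x, ⟨hxu, hxV⟩, hxS⟩ := (@mem_closure_iff X (zariski X) _ _).1 ha (u ∩ V)
    (@IsOpen.inter X (zariski X) _ _ hu hV) ⟨hau, haV⟩
  exact hsub ⟨hxu, trivial⟩ (H x ⟨hxS, hxV⟩)

/-- A mapping is regular as soon as it pulls the fractions of the target back to quotients of
regular functions. -/
theorem regularMap_of_pullback {Y : Type} [HasFractions Y] {T : Set Y} {m : X → Y}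
    (hm : Set.MapsTo m S T)
    (H : ∀ a ∈ S, ∀ φ ∈ HasFractions.fractions (X := Y), ∃ p q : X → ℂ,
      RegularAt S p a ∧ RegularAt S q a ∧
        ∀ x, (φ.2 (m x) ≠ 0 ↔ q x ≠ 0) ∧ φ.1 (m x) / φ.2 (m x) = p x / q x) :
    RegularMap S T m := by
  have hcont : @ContinuousOn X Y (zariski X) (zariski Y) m S := by
    let _ : TopologicalSpace X := zariski X
    rw [continuousOn_to_generateFrom_iff]
    rintro a ha _ ⟨φ, hφ, rfl⟩ hφa
    obtain ⟨p, q, -, hq, hpq⟩ := H a ha φ hφ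
    exact (hq.eventually_ne_zero ha ((hpq a).1.1 hφa)).mono fun x hx => (hpq x).1.2 hx
  refine ⟨hm, hcont, fun a ha h hh => ?_⟩
  obtain ⟨φ, hφ, h0, W, hW, haW, hW'⟩ := hh
  obtain ⟨p, q, hp, hq, hpq⟩ := H a ha φ hφ
  refine (hp.div hq ha ((hpq a).1.1 h0)).congr ?_
  have hpre : ∀ᶠ x in zariskiNhdsWithin S a, m x ∈ W :=
    (hcont a ha).eventually (@IsOpen.mem_nhds Y (zariski Y) _ _ hW haW)
  filter_upwards [hpre, eventually_zariskiNhdsWithin_mem] with x hx hxS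
  rw [Function.comp_apply, (hW' _ ⟨hm hxS, hx⟩).2, (hpq x).2]

/-- A mapping to `ℂⁿ` with regular coordinates is regular. -/
theorem regularMap_affine {n : ℕ} {T : Set (Fin n → ℂ)} {m : X → Fin n → ℂ}
    (hm : Set.MapsTo m S T) (H : ∀ a ∈ S, ∀ i, RegularAt S (fun x => m x i) a) :
    RegularMap S T m := by
  refine regularMap_of_pullback hm ?_
  rintro a ha _ ⟨P, Q, rfl⟩
  exact ⟨_, _, RegularAt.eval (H a ha) P, RegularAt.eval (H a ha) Q, fun x => ⟨Iff.rfl, rfl⟩⟩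

end Regular

/-! ### The chart `(s : 1)` of the projective line -/

/-- The point `(s : 1)` of `ℙ¹`. -/
noncomputable def affinePoint (s : ℂ) : ProjLine := Projectivization.mk ℂ ![s, 1] (by simp)

/-- The coordinate `s` of the point `(s : 1)`. Its value at `(1 : 0)` is the junk value `0`. -/
noncomputable def affineCoord (q : ProjLine) : ℂ := q.rep 0 / q.rep 1

theorem affinePoint_zero : affinePoint 0 = zeroOne := rfl

theorem exists_rep_affinePoint (s : ℂ) :
    ∃ c : ℂ, c ≠ 0 ∧ (affinePoint s).rep 0 = c * s ∧ (affinePoint s).rep 1 = c := by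
  obtain ⟨c, hc⟩ := Projectivization.exists_smul_eq_mk_rep ℂ ![s, 1] (by simp)
  refine ⟨c, c.ne_zero, ?_, ?_⟩
  · simpa [affinePoint, Units.smul_def] using (congrFun hc 0).symm
  · simpa [affinePoint, Units.smul_def] using (congrFun hc 1).symm

theorem rep_affinePoint_ne_zero (s : ℂ) : (affinePoint s).rep 1 ≠ 0 := by
  obtain ⟨c, hc, -, h1⟩ := exists_rep_affinePoint s
  rwa [h1]

theorem affineCoord_affinePoint (s : ℂ) : affineCoord (affinePoint s) = s := by
  obtain ⟨c, hc, h0, h1⟩ := exists_rep_affinePoint s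
  rw [affineCoord, h0, h1]
  field_simp

theorem affinePoint_affineCoord {q : ProjLine} (hq : q.rep 1 ≠ 0) : affinePoint (affineCoord q) = q := by
  conv_rhs => rw [← q.mk_rep]
  rw [affinePoint, Projectivization.mk_eq_mk_iff']
  refine ⟨(q.rep 1)⁻¹, funext fun i => ?_⟩
  fin_cases i
  · simp [affineCoord, div_eq_inv_mul]
  · simp [hq]

theorem mk_eq_affinePoint {s t c : ℂ} (h : ![s, t] ≠ 0) (hc : s = c * t) :
    Projectivization.mk ℂ ![s, t] h = affinePoint c := by
  rw [affinePoint, Projectivization.mk_eq_mk_iff']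
  refine ⟨t, funext fun i => ?_⟩
  fin_cases i
  · simp [hc, mul_comm]
  · simp

theorem eval_smul_of_isWeightedHomogeneous {n d : ℕ} {P : MvPolynomial (Fin n ⊕ Fin 2) ℂ}
    (hP : P.IsWeightedHomogeneous (Sum.elim (fun _ => 0) (fun _ => 1) : Fin n ⊕ Fin 2 → ℕ) d)
    (x : Fin n → ℂ) (y z : Fin 2 → ℂ) (c : ℂ) (h : ∀ i, z i = c * y i) :
    MvPolynomial.eval (Sum.elim x z) P = c ^ d * MvPolynomial.eval (Sum.elim x y) P := by
  simp only [MvPolynomial.eval_eq', Finset.mul_sum]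
  refine Finset.sum_congr rfl fun m hm => ?_
  have hd := hP (MvPolynomial.mem_support_iff.1 hm)
  rw [Finsupp.weight_apply, Finsupp.sum_fintype _ _ (by simp)] at hd
  simp only [Fintype.sum_sum_type, Sum.elim_inl, Sum.elim_inr, mul_zero, Finset.sum_const_zero,
    zero_add, smul_eq_mul, mul_one] at hd
  simp only [Fintype.prod_sum_type, Sum.elim_inl, Sum.elim_inr, h, mul_pow,
    Finset.prod_mul_distrib, Finset.prod_pow_eq_pow_sum, hd]
  ring

section

variable {n : ℕ} {S : Set ((Fin n → ℂ) × ProjLine)} {a : (Fin n → ℂ) × ProjLine}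

theorem regularAt_fst (i : Fin n) : RegularAt S (fun y => y.1 i) a := by
  have hφ : ((fun y => y.1 i, fun _ => 1) :
      ((Fin n → ℂ) × ProjLine → ℂ) × ((Fin n → ℂ) × ProjLine → ℂ)) ∈ HasFractions.fractions :=
    ⟨0, MvPolynomial.X (Sum.inl i), 1, MvPolynomial.isWeightedHomogeneous_X _ _ _,
      MvPolynomial.isWeightedHomogeneous_one _ _, by simp⟩
  exact (regularAt_fraction hφ (by simp)).congr (by simp)

theorem affineCoord_fraction_mem (n : ℕ) : ((fun y => y.2.rep 0, fun y => y.2.rep 1) :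
    ((Fin n → ℂ) × ProjLine → ℂ) × ((Fin n → ℂ) × ProjLine → ℂ)) ∈ HasFractions.fractions :=
  ⟨1, MvPolynomial.X (Sum.inr 0), MvPolynomial.X (Sum.inr 1),
    MvPolynomial.isWeightedHomogeneous_X _ _ _, MvPolynomial.isWeightedHomogeneous_X _ _ _,
    by simp⟩

theorem regularAt_affineCoord (ha : a.2.rep 1 ≠ 0) : RegularAt S (fun y => affineCoord y.2) a :=
  regularAt_fraction (affineCoord_fraction_mem n) ha

end

/-- A mapping `w ↦ (Φ w, (σ w : 1))` is regular if `σ` and the coordinates of `Φ` are. -/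
theorem regularMap_affinePoint {X : Type} [HasFractions X] [FractionLaws X] {S : Set X} {n : ℕ}
    {T : Set ((Fin n → ℂ) × ProjLine)} {Φ : X → Fin n → ℂ} {σ : X → ℂ}
    (hm : Set.MapsTo (fun w => (Φ w, affinePoint (σ w))) S T)
    (hΦ : ∀ a ∈ S, ∀ i, RegularAt S (fun x => Φ x i) a) (hσ : ∀ a ∈ S, RegularAt S σ a) :
    RegularMap S T (fun w => (Φ w, affinePoint (σ w))) := by
  refine regularMap_of_pullback hm ?_
  rintro a ha _ ⟨d, P, Q, hP, hQ, rfl⟩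
  let u : Fin n ⊕ Fin 2 → X → ℂ := Sum.elim (fun i x => Φ x i) ![σ, fun _ => 1]
  have hu : ∀ i, RegularAt S (u i) a := by
    rintro (i | i)
    · exact hΦ a ha i
    · fin_cases i
      · exact hσ a ha
      · exact regularAt_const 1
  refine ⟨_, _, RegularAt.eval hu P, RegularAt.eval hu Q, fun x => ?_⟩
  obtain ⟨c, hc, h0, h1⟩ := exists_rep_affinePoint (σ x)
  have hux : (fun i => u i x) = Sum.elim (Φ x) ![σ x, 1] := by
    ext (i | i)
    · rfl
    · fin_cases i <;> rfl
  have hz : ∀ i, (affinePoint (σ x)).rep i = c * (![σ x, 1] : Fin 2 → ℂ) i := by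
    intro i
    fin_cases i
    · simpa using h0
    · simpa using h1
  simp only [hux, eval_smul_of_isWeightedHomogeneous hP _ _ _ c hz,
    eval_smul_of_isWeightedHomogeneous hQ _ _ _ c hz]
  have hcd : c ^ d ≠ 0 := pow_ne_zero _ hc
  exact ⟨by simp [hcd], mul_div_mul_left _ _ hcd⟩

/-! ### A homogeneous element in the ideal of two coprime polynomials -/

/-- The homogeneous components of `p` lie in at most `s` consecutive degrees. -/
def HasSpread {σ K : Type*} [CommRing K] (p : MvPolynomial σ K) (s : ℕ) : Prop :=
  ∃ (l : ℕ) (q : ℕ → MvPolynomial σ K), (∀ i, (q i).IsHomogeneous (l + i)) ∧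
    p = ∑ i ∈ Finset.range s, q i

section Spread

variable {σ K : Type*} [CommRing K]

theorem exists_hasSpread (p : MvPolynomial σ K) : ∃ s, HasSpread p s :=
  ⟨_, 0, fun i => MvPolynomial.homogeneousComponent i p,
    fun i => by simpa using MvPolynomial.homogeneousComponent_isHomogeneous i p,
    (MvPolynomial.sum_homogeneousComponent p).symm⟩

variable [IsDomain K]

/-- Pseudo-division by an element `h` of least spread in an ideal: cross-multiplying by the top
components lowers the spread of the dividend. -/
theorem exists_isHomogeneous_mul_eq {I : Ideal (MvPolynomial σ K)} {h : MvPolynomial σ K}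
    (hI : h ∈ I) (h0 : h ≠ 0) {s : ℕ} (hs : HasSpread h s)
    (hmin : ∀ p ∈ I, ∀ r < s, HasSpread p r → p = 0) :
    ∀ (r : ℕ) (p : MvPolynomial σ K), p ∈ I → HasSpread p r →
      ∃ (u q : MvPolynomial σ K) (k : ℕ), u.IsHomogeneous k ∧ u ≠ 0 ∧ u * p = q * h := by
  intro r
  induction r with
  | zero =>
    rintro p - ⟨l, q, -, rfl⟩
    exact ⟨1, 0, 0, MvPolynomial.isHomogeneous_one _ _, one_ne_zero, by simp⟩
  | succ r ih =>
    intro p hp hpr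
    by_cases hrs : r + 1 < s
    · exact ⟨1, 0, 0, MvPolynomial.isHomogeneous_one _ _, one_ne_zero, by
        simp [hmin p hp _ hrs hpr]⟩
    obtain ⟨l, q, hq, rfl⟩ := hpr
    obtain ⟨l', t, ht, hsum⟩ := hs
    cases s with
    | zero => exact absurd (by simpa using hsum) h0
    | succ s =>
    have hts : t s ≠ 0 := fun h1 => h0 <| hmin h hI s s.lt_succ_self
      ⟨l', t, ht, by rw [hsum, Finset.sum_range_succ, h1, add_zero]⟩
    obtain ⟨e, rfl⟩ : ∃ e, r = s + e := ⟨r - s, by omega⟩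
    have hspread : HasSpread (t s * ∑ i ∈ Finset.range (s + e + 1), q i - q (s + e) * h)
        (s + e) := by
      refine ⟨l + l' + s, fun i => t s * q i - if e ≤ i then q (s + e) * t (i - e) else 0, ?_, ?_⟩
      · intro i
        refine MvPolynomial.IsHomogeneous.sub ?_ ?_
        · convert (ht s).mul (hq i) using 1
          omega
        · split_ifs with hi
          · convert (hq (s + e)).mul (ht (i - e)) using 1
            omega
          · exact MvPolynomial.isHomogeneous_zero _ _ _
      · rw [Finset.sum_sub_distrib, ← Finset.mul_sum, Finset.sum_range_succ, hsum,
          Finset.sum_range_succ, add_comm s e, Finset.sum_range_add]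
        have h1 : ∑ i ∈ Finset.range e,
            (if e ≤ i then q (e + s) * t (i - e) else 0) = 0 :=
          Finset.sum_eq_zero fun i hi => if_neg (by simpa using hi)
        simp only [h1, Finset.sum_range_add, Nat.le_add_right, if_true, Nat.add_sub_cancel_left,
          zero_add, ← Finset.mul_sum]
        ring
    obtain ⟨u, w, k, hu, hu0, huw⟩ := ih _
      (I.sub_mem (I.mul_mem_left _ hp) (I.mul_mem_left _ hI)) hspread
    exact ⟨u * t s, w + u * q (s + e), _, hu.mul (ht s), mul_ne_zero hu0 hts, by
      linear_combination huw⟩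

/-- If the prime polynomial `p` does not divide `g`, then the ideal `(p, g)` contains a nonzero
homogeneous polynomial. Geometrically: the cone with vertex `0` over the common zero set, which
has codimension at least two, is contained in a hypersurface. -/
theorem exists_isHomogeneous_mem_span_pair {p g : MvPolynomial σ K} (hp : Prime p)
    (hpg : ¬ p ∣ g) : ∃ (D : MvPolynomial σ K) (k : ℕ),
      D ∈ Ideal.span {p, g} ∧ D.IsHomogeneous k ∧ D ≠ 0 := by
  classical
  have hpI : p ∈ Ideal.span {p, g} := Ideal.subset_span (by simp)
  have hgI : g ∈ Ideal.span {p, g} := Ideal.subset_span (by simp)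
  have hex : ∃ s, ∃ h ∈ Ideal.span {p, g}, h ≠ 0 ∧ HasSpread h s :=
    (exists_hasSpread p).imp fun s hs => ⟨p, hpI, hp.ne_zero, hs⟩
  obtain ⟨h, hI, h0, hs⟩ := Nat.find_spec hex
  have hmin : ∀ x ∈ Ideal.span {p, g}, ∀ r < Nat.find hex, HasSpread x r → x = 0 := by
    intro x hx r hr hxr
    by_contra hx0
    exact Nat.find_min hex hr ⟨x, hx, hx0, hxr⟩
  obtain ⟨r, hr⟩ := exists_hasSpread p
  obtain ⟨r', hr'⟩ := exists_hasSpread g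
  obtain ⟨u, q, k, hu, hu0, huq⟩ := exists_isHomogeneous_mul_eq hI h0 hs hmin r p hpI hr
  obtain ⟨u', q', k', hu', hu0', huq'⟩ := exists_isHomogeneous_mul_eq hI h0 hs hmin r' g hgI hr'
  rcases hp.dvd_or_dvd (huq ▸ dvd_mul_left p u) with ⟨w, rfl⟩ | hph
  · exact ⟨u, k, by
      rw [show u = w * h from mul_right_cancel₀ hp.ne_zero (by linear_combination huq)]
      exact Ideal.mul_mem_left _ _ hI, hu, hu0⟩
  · obtain ⟨w, rfl⟩ := (hp.dvd_or_dvd (huq' ▸ hph.mul_left q')).resolve_right hpg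
    exact ⟨_, k', Ideal.mul_mem_right _ _ hpI, hu', hu0'⟩

end Spread

/-! ### Elimination along a line -/

section Line

variable {n : ℕ}

/-- The substitution `p(y) ↦ p(y + T v)`, with values in `ℂ[y][T]`. -/
noncomputable def lineHom (v : Fin n → ℂ) :
    MvPolynomial (Fin n) ℂ →ₐ[ℂ] Polynomial (MvPolynomial (Fin n) ℂ) :=
  MvPolynomial.aeval fun i => Polynomial.C (MvPolynomial.X i) +
    Polynomial.C (MvPolynomial.C (v i)) * Polynomial.X

/-- The value of `p ∈ ℂ[y][T]` at `(y, T)`. -/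
noncomputable def evalLine (y : Fin n → ℂ) (T : ℂ) :
    Polynomial (MvPolynomial (Fin n) ℂ) →+* ℂ :=
  Polynomial.eval₂RingHom (MvPolynomial.eval y) T

theorem evalLine_lineHom (v y : Fin n → ℂ) (T : ℂ) (p : MvPolynomial (Fin n) ℂ) :
    evalLine y T (lineHom v p) = MvPolynomial.eval (y + T • v) p := by
  induction p using MvPolynomial.induction_on with
  | C c =>
    have : lineHom v (MvPolynomial.C c) = Polynomial.C (MvPolynomial.C c) :=
      (lineHom v).commutes c
    simp [this, evalLine]
  | add p q hp hq => simp [hp, hq]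
  | mul_X p i hp =>
    rw [map_mul, map_mul, hp, map_mul]
    simp [lineHom, evalLine, mul_comm (v i) T]

/-- For homogeneous `p` of degree `k`, the coefficient of `T ^ k` in `p(y + T v)` is the constant
`p(v)`. -/
theorem lineHom_isHomogeneous (v : Fin n → ℂ) {k : ℕ} {p : MvPolynomial (Fin n) ℂ}
    (hp : p.IsHomogeneous k) : (lineHom v p).natDegree ≤ k ∧
      (lineHom v p).coeff k = MvPolynomial.C (MvPolynomial.eval v p) := by
  have hmon : ∀ d : Fin n →₀ ℕ, (lineHom v (MvPolynomial.monomial d 1)).natDegree ≤ d.degree ∧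
      (lineHom v (MvPolynomial.monomial d 1)).coeff d.degree =
        MvPolynomial.C (MvPolynomial.eval v (MvPolynomial.monomial d 1)) := by
    intro d
    induction d using Finsupp.induction_linear with
    | zero =>
      rw [show MvPolynomial.monomial (0 : Fin n →₀ ℕ) (1 : ℂ) = 1 from rfl]
      simp
    | add d e hd he =>
      have hmul : MvPolynomial.monomial (d + e) (1 : ℂ) =
          MvPolynomial.monomial d 1 * MvPolynomial.monomial e 1 := by simp
      rw [hmul, map_mul, map_mul, map_mul, map_add]
      exact ⟨Polynomial.natDegree_mul_le_of_le hd.1 he.1, by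
        rw [Polynomial.coeff_mul_add_eq_of_natDegree_le hd.1 he.1, hd.2, he.2]⟩
    | single i m =>
      have hX : lineHom v (MvPolynomial.X i) = Polynomial.C (MvPolynomial.X i) +
          Polynomial.C (MvPolynomial.C (v i)) * Polynomial.X := by simp [lineHom]
      have h1 : (lineHom v (MvPolynomial.X i)).natDegree ≤ 1 := by
        rw [hX]
        compute_degree
      have h2 : (lineHom v (MvPolynomial.X i)).coeff 1 = MvPolynomial.C (v i) := by
        rw [hX]
        simp [Polynomial.coeff_C]
      rw [← MvPolynomial.X_pow_eq_monomial, map_pow, map_pow, Finsupp.degree_single]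
      refine ⟨by simpa using Polynomial.natDegree_pow_le_of_le m h1, ?_⟩
      have := Polynomial.coeff_pow_of_natDegree_le h1 (m := m)
      rw [mul_one] at this
      rw [this, h2]
      simp
  have hterm : ∀ d ∈ p.support,
      (lineHom v (MvPolynomial.monomial d (p.coeff d))).natDegree ≤ k ∧
      (lineHom v (MvPolynomial.monomial d (p.coeff d))).coeff k =
        MvPolynomial.C (MvPolynomial.eval v (MvPolynomial.monomial d (p.coeff d))) := by
    intro d hd
    have hdk : d.degree = k := by
      have := hp (MvPolynomial.mem_support_iff.1 hd)
      rwa [Finsupp.degree_eq_weight_one]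
    have hsm : MvPolynomial.monomial d (p.coeff d) =
        p.coeff d • MvPolynomial.monomial d (1 : ℂ) := by
      rw [MvPolynomial.smul_monomial, smul_eq_mul, mul_one]
    rw [hsm, map_smul, ← hdk]
    refine ⟨(Polynomial.natDegree_smul_le _ _).trans (hmon d).1, ?_⟩
    rw [Polynomial.coeff_smul, (hmon d).2, MvPolynomial.smul_eval, map_mul,
      MvPolynomial.smul_eq_C_mul]
  have hsum := p.as_sum
  constructor
  · rw [hsum, map_sum]
    exact Polynomial.natDegree_sum_le_of_forall_le _ _ fun d hd => (hterm d hd).1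
  · conv_lhs => rw [hsum, map_sum, Polynomial.finsetSum_coeff]
    conv_rhs => rw [hsum, map_sum, map_sum]
    exact Finset.sum_congr rfl fun d hd => (hterm d hd).2

/-- The restriction of `p` to the line `ℂ v`, a polynomial in `T`. -/
noncomputable def restrictLine (v : Fin n → ℂ) (p : MvPolynomial (Fin n) ℂ) : Polynomial ℂ :=
  (lineHom v p).map (MvPolynomial.eval 0)

theorem eval_restrictLine (v : Fin n → ℂ) (p : MvPolynomial (Fin n) ℂ) (T : ℂ) :
    (restrictLine v p).eval T = MvPolynomial.eval (T • v) p := by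
  rw [restrictLine, Polynomial.eval_map, ← zero_add (T • v), ← evalLine_lineHom]
  rfl

theorem coeff_zero_restrictLine (v : Fin n → ℂ) (p : MvPolynomial (Fin n) ℂ) :
    (restrictLine v p).coeff 0 = MvPolynomial.eval 0 p := by
  rw [Polynomial.coeff_zero_eq_eval_zero, eval_restrictLine, zero_smul]

theorem eval_smul_of_isHomogeneous {k : ℕ} {p : MvPolynomial (Fin n) ℂ} (hp : p.IsHomogeneous k)
    (v : Fin n → ℂ) (T : ℂ) :
    MvPolynomial.eval (T • v) p = MvPolynomial.eval v p * T ^ k := by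
  simp only [MvPolynomial.eval_eq', Finset.sum_mul]
  refine Finset.sum_congr rfl fun m hm => ?_
  have hd : m.degree = k := by
    rw [Finsupp.degree_eq_weight_one]
    exact hp (MvPolynomial.mem_support_iff.1 hm)
  rw [Finsupp.degree_eq_sum] at hd
  simp only [Pi.smul_apply, smul_eq_mul, mul_pow, Finset.prod_mul_distrib,
    Finset.prod_pow_eq_pow_sum, hd]
  ring

/-- Let `I` be an ideal of `A[T]` that contains a monic polynomial, and let `A → K` be a residue
field over which the image of `I` contains `T`. Then `A[T] / I` is finite over `A` with fibre
generated by `1`, so by the lemma of Nakayama `T` is congruent modulo `I` to an element of `A`, up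
to a denominator that is a unit at the point. -/
theorem exists_linear_mem_of_monic {A K : Type*} [CommRing A] [Field K] (ev : A →+* K)
    (hev : Function.Surjective ev) {I : Ideal (Polynomial A)} {m : Polynomial A} (hm : m.Monic)
    (hmI : m ∈ I) (hT : Polynomial.X ∈ I.map (Polynomial.mapRingHom ev)) :
    ∃ r q : A, ev r = 1 ∧ Polynomial.C r * Polynomial.X - Polynomial.C q ∈ I := by
  have hred : Function.Surjective (Polynomial.mapRingHom ev) := Polynomial.map_surjective _ hev
  have hfin : Module.Finite A (Polynomial A ⧸ I) := by
    have := hm.finite_quotient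
    have hle : Ideal.span {m} ≤ I := (Ideal.span_singleton_le_iff_mem _).2 hmI
    exact Module.Finite.of_surjective (Ideal.Quotient.factorₐ A hle).toLinearMap
      (Ideal.Quotient.factor_surjective hle)
  have hgen : ∀ z : Polynomial A, ∃ c : A, ∃ i ∈ I, ∃ j ∈ (RingHom.ker ev).map Polynomial.C,
      z = Polynomial.C c + (i + j) := by
    intro z
    obtain ⟨c, hc⟩ := hev ((z.map ev).coeff 0)
    have h1 : z - Polynomial.C c ∈
        Ideal.comap (Polynomial.mapRingHom ev) (I.map (Polynomial.mapRingHom ev)) := by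
      rw [Ideal.mem_comap, map_sub, Polynomial.coe_mapRingHom, Polynomial.map_C, hc]
      obtain ⟨w, hw⟩ := Polynomial.X_dvd_sub_C (p := z.map ev)
      rw [hw]
      exact Ideal.mul_mem_right _ _ hT
    rw [Ideal.comap_map_of_surjective _ hred, ← RingHom.ker_eq_comap_bot,
      Polynomial.ker_mapRingHom] at h1
    obtain ⟨i, hi, j, hj, hij⟩ := Submodule.mem_sup.1 h1
    exact ⟨c, i, hi, j, hj, by rw [hij]; ring⟩
  have hsmul : ∀ (c : A) (z : Polynomial A),
      c • Ideal.Quotient.mk I z = Ideal.Quotient.mk I (Polynomial.C c * z) := by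
    intro c z
    rw [← Polynomial.smul_eq_C_mul]
    rfl
  have hle : (⊤ : Submodule A (Polynomial A ⧸ I)) ≤
      Submodule.span A {1} ⊔ RingHom.ker ev • (⊤ : Submodule A (Polynomial A ⧸ I)) := by
    rintro z -
    obtain ⟨z, rfl⟩ := Ideal.Quotient.mk_surjective z
    obtain ⟨c, i, hi, j, hj, rfl⟩ := hgen z
    rw [map_add, map_add, Ideal.Quotient.eq_zero_iff_mem.2 hi, zero_add]
    refine add_mem (Submodule.mem_sup_left ?_) (Submodule.mem_sup_right ?_)
    · exact Submodule.mem_span_singleton.2 ⟨c, (hsmul c 1).trans (by rw [mul_one])⟩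
    · rw [Ideal.smul_top_eq_map]
      have := Ideal.mem_map_of_mem (Ideal.Quotient.mk I) hj
      rwa [Ideal.map_map] at this
  obtain ⟨r, hr, hr'⟩ := Submodule.exists_sub_one_mem_and_smul_le_of_fg_of_le_sup
    hfin.fg_top le_top hle
  obtain ⟨q, hq⟩ := Submodule.mem_span_singleton.1
    (hr' (Submodule.smul_mem_pointwise_smul (Ideal.Quotient.mk I Polynomial.X) r ⊤ trivial))
  refine ⟨r, q, ?_, ?_⟩
  · have : ev (r - 1) = 0 := hr
    rwa [map_sub, map_one, sub_eq_zero] at this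
  · rw [← Ideal.Quotient.eq_zero_iff_mem, map_sub, sub_eq_zero, ← hsmul, ← hq,
      ← mul_one (Polynomial.C q), ← hsmul]
    rfl

/-- If `p` has a simple zero at the origin of the line `ℂ v` and the ideal `(p, g)` contains a
homogeneous polynomial `D` not vanishing at `v`, then near `0` the common zero set of `p` and `g` is
contained in a graph over a complement of the line. Indeed `D(y + T v)` is, up to a constant, monic
in `T` and reduces to a power of `T` at `y = 0`. -/
theorem exists_linear_mem_span_pair {v : Fin n → ℂ} {p g D : MvPolynomial (Fin n) ℂ} {k : ℕ}
    (hD : D ∈ Ideal.span {p, g}) (hDk : D.IsHomogeneous k) (hDv : MvPolynomial.eval v D ≠ 0)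
    (hp0 : MvPolynomial.eval 0 p = 0) (hp1 : (restrictLine v p).coeff 1 ≠ 0) :
    ∃ (r q : MvPolynomial (Fin n) ℂ) (a b : Polynomial (MvPolynomial (Fin n) ℂ)),
      MvPolynomial.eval 0 r = 1 ∧ Polynomial.C r * Polynomial.X - Polynomial.C q =
        a * lineHom v p + b * lineHom v g := by
  set I : Ideal (Polynomial (MvPolynomial (Fin n) ℂ)) := Ideal.span {lineHom v p, lineHom v g}
  let red := Polynomial.mapRingHom (MvPolynomial.eval (0 : Fin n → ℂ))
  have hpI : lineHom v p ∈ I := Ideal.subset_span (by simp)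
  have hDI : lineHom v D ∈ I := by
    obtain ⟨a, b, rfl⟩ := Ideal.mem_span_pair.1 hD
    exact Ideal.mem_span_pair.2 ⟨lineHom v a, lineHom v b, by simp⟩
  set c := MvPolynomial.eval v D
  obtain ⟨hdeg, hlead⟩ := lineHom_isHomogeneous v hDk
  have hm : (Polynomial.C (MvPolynomial.C c⁻¹) * lineHom v D).Monic := by
    refine Polynomial.monic_of_natDegree_le_of_coeff_eq_one k
      ((Polynomial.natDegree_C_mul_le _ _).trans hdeg) ?_
    rw [Polynomial.coeff_C_mul, hlead, ← map_mul, inv_mul_cancel₀ hDv, map_one]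
  have hT : Polynomial.X ∈ I.map red := by
    have h1 : restrictLine v p ∈ I.map red := Ideal.mem_map_of_mem red hpI
    have h2 : (Polynomial.X : Polynomial ℂ) ^ k ∈ I.map red := by
      have h3 : restrictLine v D = Polynomial.C c * Polynomial.X ^ k := by
        refine Polynomial.funext fun T => ?_
        rw [eval_restrictLine, eval_smul_of_isHomogeneous hDk]
        simp [c]
      have h4 := (I.map red).mul_mem_left (Polynomial.C c⁻¹) (Ideal.mem_map_of_mem red hDI)
      rwa [show red (lineHom v D) = restrictLine v D from rfl, h3, ← mul_assoc, ← map_mul,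
        inv_mul_cancel₀ hDv, map_one, one_mul] at h4
    obtain ⟨u, hu⟩ : Polynomial.X ∣ restrictLine v p :=
      Polynomial.X_dvd_iff.2 ((coeff_zero_restrictLine v p).trans hp0)
    have hu0 : u.coeff 0 ≠ 0 := by rwa [hu, Polynomial.coeff_X_mul] at hp1
    have hcop : IsCoprime u (Polynomial.X ^ k) :=
      (IsCoprime.symm (Polynomial.irreducible_X.coprime_iff_not_dvd.2 fun hdvd =>
        hu0 (Polynomial.X_dvd_iff.1 hdvd))).pow_right
    obtain ⟨x, y, hxy⟩ := hcop
    have : (Polynomial.X : Polynomial ℂ) =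
        x * restrictLine v p + y * Polynomial.X * Polynomial.X ^ k := by
      rw [hu]
      linear_combination -Polynomial.X * hxy
    rw [this]
    exact add_mem (Ideal.mul_mem_left _ _ h1) (Ideal.mul_mem_left _ _ h2)
  obtain ⟨r, q, hr, hmem⟩ := exists_linear_mem_of_monic _ (fun c => ⟨MvPolynomial.C c, by simp⟩)
    hm (I.mul_mem_left _ hDI) hT
  obtain ⟨a, b, hab⟩ := Ideal.mem_span_pair.1 hmem
  exact ⟨r, q, a, b, hr, hab.symm⟩

end Line

/-! ### Regular functions on affine space -/

section Affine

variable {n : ℕ}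

theorem regularAt_apply {S : Set (Fin n → ℂ)} {a : Fin n → ℂ} (i : Fin n) :
    RegularAt S (fun x => x i) a := by
  have hφ : ((fun x => x i, fun _ => 1) : ((Fin n → ℂ) → ℂ) × ((Fin n → ℂ) → ℂ)) ∈
      HasFractions.fractions := ⟨MvPolynomial.X i, 1, by simp⟩
  exact (regularAt_fraction hφ (by simp)).congr (by simp)

theorem RegularAt.of_isOpen {X : Type} [HasFractions X] {S : Set X} {a : X} {h : X → ℂ}
    (hh : RegularAt S h a) (hS : IsOpen[zariski X] S) (ha : a ∈ S) : RegularAt Set.univ h a := by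
  obtain ⟨φ, hφ, h0, W, hW, haW, H⟩ := hh
  exact ⟨φ, hφ, h0, W ∩ S, @IsOpen.inter X (zariski X) _ _ hW hS, ⟨haW, ha⟩,
    fun x hx => H x ⟨hx.2.2, hx.2.1⟩⟩

theorem tendsto_zariskiNhdsWithin {X : Type} [HasFractions X] [FractionLaws X] {S : Set X} {a : X}
    {m : X → Fin n → ℂ} (haS : a ∈ S) (hm : ∀ i, RegularAt S (fun x => m x i) a) :
    Tendsto m (zariskiNhdsWithin S a) (zariskiNhdsWithin Set.univ (m a)) := by
  rw [zariskiNhdsWithin, zariskiNhdsWithin, @nhdsWithin_univ _ (zariski _),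
    TopologicalSpace.tendsto_nhds_generateFrom_iff]
  rintro _ ⟨_, ⟨P, Q, rfl⟩, rfl⟩ ha
  exact (RegularAt.eval hm Q).eventually_ne_zero haS ha

theorem RegularAt.comp {X : Type} [HasFractions X] [FractionLaws X] {S : Set X} {a : X}
    {m : X → Fin n → ℂ} {h : (Fin n → ℂ) → ℂ} {b : Fin n → ℂ} (hh : RegularAt Set.univ h b)
    (hb : m a = b) (haS : a ∈ S) (hm : ∀ i, RegularAt S (fun x => m x i) a) :
    RegularAt S (fun x => h (m x)) a := by
  subst hb
  obtain ⟨_, ⟨P, Q, rfl⟩, h0, H⟩ := regularAt_iff.1 hh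
  refine ((RegularAt.eval hm P).div (RegularAt.eval hm Q) haS h0).congr ?_
  exact ((tendsto_zariskiNhdsWithin haS hm).eventually H).mono fun x hx => hx.2

/-- A polynomial that vanishes on a nonempty Zariski open set is zero. -/
theorem eq_zero_of_vanishes_on_isOpen {W : Set (Fin n → ℂ)} (hW : IsOpen[zariski _] W)
    {a : Fin n → ℂ} (ha : a ∈ W) {N : MvPolynomial (Fin n) ℂ}
    (hN : ∀ x ∈ W, MvPolynomial.eval x N = 0) : N = 0 := by
  have hW' : IsOpen W := by
    have hle : (Pi.topologicalSpace : TopologicalSpace (Fin n → ℂ)) ≤ zariski (Fin n → ℂ) := by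
      apply le_generateFrom
      rintro _ ⟨_, ⟨P, Q, rfl⟩, rfl⟩
      exact isOpen_ne_fun (MvPolynomial.continuous_eval Q) continuous_const
    exact hle W hW
  obtain ⟨ε, hε, hball⟩ := Metric.isOpen_iff.1 hW' a ha
  refine MvPolynomial.funext_set (fun i => Metric.ball (a i) ε)
    (fun i => infinite_of_mem_nhds (a i) (Metric.ball_mem_nhds _ hε)) fun x hx => ?_
  rw [map_zero]
  refine hN x (hball ?_)
  rw [← ball_pi _ hε] at hx
  exact hx

theorem mem_closure_ne_zero_inter {N : MvPolynomial (Fin n) ℂ} (hN : N ≠ 0)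
    {W : Set (Fin n → ℂ)} (hW : IsOpen[zariski _] W) {a : Fin n → ℂ} (ha : a ∈ W) :
    a ∈ closure[zariski _] ({x | MvPolynomial.eval x N ≠ 0} ∩ W) := by
  refine (@mem_closure_iff _ (zariski _) _ _).2 fun O hO haO => ?_
  by_contra hempty
  refine hN (eq_zero_of_vanishes_on_isOpen (@IsOpen.inter _ (zariski _) _ _ hO hW) ⟨haO, ha⟩
    fun x hx => ?_)
  by_contra hne
  exact hempty ⟨x, hx.1, hne, hx.2⟩

/-- A regular function that is nonzero as a germ has dense non-vanishing locus near `0`. -/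
theorem RegularAt.exists_ne_zero_imp {h : (Fin n → ℂ) → ℂ} (hh : RegularAt Set.univ h 0)
    (hne : ¬ ∀ᶠ x in zariskiNhds n, h x = 0) : ∃ N : MvPolynomial (Fin n) ℂ, N ≠ 0 ∧
      ∀ᶠ x in zariskiNhds n, MvPolynomial.eval x N ≠ 0 → h x ≠ 0 := by
  obtain ⟨N, Q, hQ, H⟩ := regularAt_zero_iff.1 hh
  refine ⟨N, ?_, H.mono fun x hx hN => by rw [hx.2]; exact div_ne_zero hN hx.1⟩
  rintro rfl
  exact hne (H.mono fun x hx => by rw [hx.2, map_zero, zero_div])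

end Affine

/-! ### Charts of the local blowup -/

theorem exists_isOpen_of_eventually {X : Type} [HasFractions X] {a : X} {p : X → Prop}
    (h : ∀ᶠ x in zariskiNhdsWithin Set.univ a, p x) :
    ∃ W, IsOpen[zariski X] W ∧ a ∈ W ∧ ∀ x ∈ W, p x := by
  obtain ⟨W, hW, ha, H⟩ := mem_zariskiNhdsWithin.1 h
  exact ⟨W, hW, ha, fun x hx => H ⟨hx, trivial⟩⟩

/-- A chart of the local blowup at `(0, (0 : 1))`: germs of regular mappings
`w ↦ (Φ w, (σ w : 1))` with values in the hypersurface `F(x) = s G(x)`, and `τ` in the opposite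
direction, that are inverse to each other over the locus `G ≠ 0`. Since that locus is dense, they
are inverse to each other on the closure. -/
theorem germIso_of_chart {n : ℕ} {U : Set (Fin n → ℂ)} (hU : IsOpen[zariski (Fin n → ℂ)] U)
    (h0U : (0 : Fin n → ℂ) ∈ U) {F G : (Fin n → ℂ) → ℂ} (hG : RegularAt Set.univ G 0)
    {Φ : (Fin n → ℂ) → Fin n → ℂ} {σ : (Fin n → ℂ) → ℂ} {τ : (Fin n → ℂ) × ProjLine → Fin n → ℂ}
    (hΦ : ∀ i, RegularAt Set.univ (fun w => Φ w i) 0) (hσ : RegularAt Set.univ σ 0)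
    (hτ : ∀ i, RegularAt Set.univ (fun y => τ y i) ((0 : Fin n → ℂ), zeroOne))
    (hΦ0 : Φ 0 = 0) (hσ0 : σ 0 = 0) (hτ0 : τ (0, zeroOne) = 0)
    (h1 : ∀ᶠ w in zariskiNhds n, F (Φ w) = σ w * G (Φ w))
    (h2 : ∀ᶠ w in zariskiNhds n, G (Φ w) ≠ 0 → τ (Φ w, affinePoint (σ w)) = w)
    (h3 : ∀ᶠ y in zariskiNhdsWithin Set.univ ((0 : Fin n → ℂ), zeroOne), ∀ s,
      y.2 = affinePoint s → F y.1 = s * G y.1 → G y.1 ≠ 0 → Φ (τ y) = y.1)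
    (h4 : ¬ ∀ᶠ w in zariskiNhds n, G (Φ w) = 0) :
    ((0 : Fin n → ℂ), zeroOne) ∈ localBlowup U F G ∧
      GermIso (localBlowup U F G) ((0 : Fin n → ℂ), zeroOne)
        (Set.univ : Set (Fin n → ℂ)) 0 := by
  let k : (Fin n → ℂ) → (Fin n → ℂ) × ProjLine := fun w => (Φ w, affinePoint (σ w))
  have hk0 : k 0 = (0, zeroOne) := by simp only [k, hΦ0, hσ0, affinePoint_zero]
  obtain ⟨N, hN, hNG⟩ := (hG.comp hΦ0 (Set.mem_univ _) hΦ).exists_ne_zero_imp h4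
  rw [zariskiNhds_eq_within] at h1 h2 hNG
  have hΦU : ∀ᶠ w in zariskiNhdsWithin Set.univ (0 : Fin n → ℂ), Φ w ∈ U := by
    refine (tendsto_zariskiNhdsWithin (Set.mem_univ _) hΦ).eventually ?_
    rw [hΦ0]
    exact mem_zariskiNhdsWithin.2 ⟨U, hU, h0U, Set.inter_subset_left⟩
  obtain ⟨W₀, hW₀, h0W₀, HW⟩ := exists_isOpen_of_eventually
    ((eventually_all.2 fun i => (hΦ i).eventually).and
      (hσ.eventually.and (hΦU.and (h1.and (h2.and hNG)))))
  have hτW₀ : ∀ᶠ y in zariskiNhdsWithin Set.univ ((0 : Fin n → ℂ), zeroOne), τ y ∈ W₀ := by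
    refine (tendsto_zariskiNhdsWithin (Set.mem_univ _) hτ).eventually ?_
    rw [hτ0]
    exact mem_zariskiNhdsWithin.2 ⟨W₀, hW₀, h0W₀, Set.inter_subset_left⟩
  have hrep : ∀ᶠ y in zariskiNhdsWithin Set.univ ((0 : Fin n → ℂ), zeroOne), y.2.rep 1 ≠ 0 :=
    eventually_fraction_ne_zero (affineCoord_fraction_mem n)
      (by rw [← affinePoint_zero]; exact rep_affinePoint_ne_zero 0)
  obtain ⟨V, hV, h0V, HV⟩ := exists_isOpen_of_eventually
    ((eventually_all.2 fun i => (hτ i).eventually).and (hrep.and (hτW₀.and h3)))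
  have hkreg : RegularMap W₀ Set.univ k :=
    regularMap_affinePoint (fun _ _ => trivial)
      (fun a ha i => ((HW a ha).1 i).mono (Set.subset_univ _))
      (fun a ha => (HW a ha).2.1.mono (Set.subset_univ _))
  set W : Set (Fin n → ℂ) := W₀ ∩ k ⁻¹' V with hWdef
  have hW : IsOpen[zariski _] W :=
    @ContinuousOn.isOpen_inter_preimage _ _ (zariski _) (zariski _) _ _ _ hkreg.2.1 hW₀ hV
  have h0W : (0 : Fin n → ℂ) ∈ W := ⟨h0W₀, by rw [Set.mem_preimage, hk0]; exact h0V⟩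
  -- both identities extend from a dense subset because they equate regular functions
  have hτk : ∀ w ∈ W, τ (k w) = w := by
    intro w hw
    ext i
    have hreg : RegularAt Set.univ (fun x => τ (k x) i - x i) w :=
      ((hkreg.2.2 w hw.1 _ ((HV _ hw.2).1 i)).of_isOpen hW₀ hw.1).sub (regularAt_apply i)
    refine sub_eq_zero.1 (hreg.eq_zero_of_mem_closure hW hw (mem_closure_ne_zero_inter hN hW hw)
      fun x hx => sub_eq_zero.2 ?_)
    obtain ⟨-, -, -, -, h2x, hNx⟩ := HW x hx.2.1
    exact congrFun (h2x (hNx hx.1.1)) i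
  have hkBl : ∀ w ∈ W₀, k w ∈ localBlowup U F G := by
    intro w hw
    refine ⟨(HW w hw).2.2.1, ?_⟩
    have hc := hkreg.2.1 w hw
    refine @ContinuousWithinAt.mem_closure _ _ (zariski _) (zariski _) _ _ _ _
      (@ContinuousWithinAt.mono _ _ (zariski _) (zariski _) _ _ _ _ hc Set.inter_subset_right)
      (mem_closure_ne_zero_inter hN hW₀ hw) ?_
    rintro x ⟨hNx, hx⟩
    obtain ⟨-, -, hxU, h1x, -, hGx⟩ := HW x hx
    have hne : ![F (Φ x), G (Φ x)] ≠ 0 := fun h => hGx hNx (by simpa using congrFun h 1)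
    exact ⟨hxU, hne, (mk_eq_affinePoint hne h1x).symm⟩
  have hkτ : ∀ y ∈ localBlowup U F G ∩ V, k (τ y) = y := by
    rintro y ⟨⟨-, hy⟩, hyV⟩
    have hgraph : ∀ z ∈ ratioGraph U F G ∩ V, Φ (τ z) = z.1 ∧ σ (τ z) = affineCoord z.2 := by
      rintro z ⟨⟨-, hne, hz⟩, hzV⟩
      obtain ⟨-, hz1, hzW, h3z⟩ := HV z hzV
      have hs := affinePoint_affineCoord hz1
      have hs' := hs.trans hz
      rw [eq_comm, affinePoint, Projectivization.mk_eq_mk_iff'] at hs'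
      obtain ⟨c, hc⟩ := hs'
      have hc0 : c * affineCoord z.2 = F z.1 := by simpa using congrFun hc 0
      have hc1 : c = G z.1 := by simpa using congrFun hc 1
      have hGz : G z.1 ≠ 0 := by
        intro hG0
        rw [← hc, hc1, hG0, zero_smul] at hne
        exact hne rfl
      have hFz : F z.1 = affineCoord z.2 * G z.1 := by rw [← hc0, ← hc1, mul_comm]
      have hΦz := h3z _ hs.symm hFz hGz
      refine ⟨hΦz, ?_⟩
      have h1z := (HW _ hzW).2.2.2.1
      rw [hΦz, hFz] at h1z
      exact (mul_right_cancel₀ hGz h1z).symm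
    obtain ⟨hτy, hy1, hyW, -⟩ := HV y hyV
    obtain ⟨hΦy, hσy, -⟩ := HW _ hyW
    refine Prod.ext (funext fun i => ?_) ?_
    · have hreg : RegularAt Set.univ (fun z => Φ (τ z) i - z.1 i) y :=
        ((hΦy i).comp rfl (Set.mem_univ _) hτy).sub (regularAt_fst i)
      exact sub_eq_zero.1 (hreg.eq_zero_of_mem_closure hV hyV hy
        fun z hz => sub_eq_zero.2 (congrFun (hgraph z hz).1 i))
    · have hreg : RegularAt Set.univ (fun z => σ (τ z) - affineCoord z.2) y :=
        (hσy.comp rfl (Set.mem_univ _) hτy).sub (regularAt_affineCoord hy1)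
      have := sub_eq_zero.1 (hreg.eq_zero_of_mem_closure hV hyV hy
        fun z hz => sub_eq_zero.2 (hgraph z hz).2)
      simp only [k, this, affinePoint_affineCoord hy1]
  have hmem : ((0 : Fin n → ℂ), zeroOne) ∈ localBlowup U F G := hk0 ▸ hkBl 0 h0W₀
  refine ⟨hmem, hmem, trivial, V, W, τ, k, hV, h0V, hW, h0W, ?_, ?_, hkτ,
    fun w hw => hτk w hw.2, hτ0, hk0⟩
  · refine regularMap_affine (fun y hy => ⟨trivial, (HV y hy.2).2.2.1, ?_⟩)
      fun y hy i => ((HV y hy.2).1 i).mono (Set.subset_univ _)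
    rw [Set.mem_preimage, hkτ y hy]
    exact hy.2
  · exact regularMap_affinePoint (fun w hw => ⟨hkBl w hw.2.1, hw.2.2⟩)
      (fun a ha i => ((HW a ha.2.1).1 i).mono (Set.subset_univ _))
      (fun a ha => (HW a ha.2.1).2.1.mono (Set.subset_univ _))

/-! ### The chart obtained by elimination -/

theorem RegularAt.eventually_ne {n : ℕ} {h : (Fin n → ℂ) → ℂ} (hh : RegularAt Set.univ h 0)
    (h0 : h 0 ≠ 0) : ∀ᶠ x in zariskiNhds n, h x ≠ 0 := by
  rw [zariskiNhds_eq_within]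
  exact hh.eventually_ne_zero trivial h0

theorem tendsto_zariskiNhds {n : ℕ} {m : (Fin n → ℂ) → Fin n → ℂ} (hm0 : m 0 = 0)
    (hm : ∀ i, RegularAt Set.univ (fun x => m x i) 0) :
    Tendsto m (zariskiNhds n) (zariskiNhds n) := by
  have := tendsto_zariskiNhdsWithin (Set.mem_univ 0) hm
  rwa [hm0, ← zariskiNhds_eq_within] at this

theorem tendsto_fst_zariskiNhds (n : ℕ) :
    Tendsto (fun y : (Fin n → ℂ) × ProjLine => y.1)
      (zariskiNhdsWithin Set.univ (0, zeroOne)) (zariskiNhds n) := by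
  rw [zariskiNhds_eq_within]
  exact tendsto_zariskiNhdsWithin (Set.mem_univ _) regularAt_fst

/-- Where `G` is invertible, the blowup is the graph of `F / G`. -/
theorem germIso_localBlowup_of_ne_zero {n : ℕ} {U : Set (Fin n → ℂ)}
    (hU : IsOpen[zariski (Fin n → ℂ)] U) (h0U : (0 : Fin n → ℂ) ∈ U) {F G : (Fin n → ℂ) → ℂ}
    (hF : RegularAt Set.univ F 0) (hG : RegularAt Set.univ G 0) (hF0 : F 0 = 0) (hG0 : G 0 ≠ 0) :
    ((0 : Fin n → ℂ), zeroOne) ∈ localBlowup U F G ∧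
      GermIso (localBlowup U F G) ((0 : Fin n → ℂ), zeroOne)
        (Set.univ : Set (Fin n → ℂ)) 0 := by
  refine germIso_of_chart hU h0U hG (Φ := id) (σ := fun w => F w / G w) (τ := fun y => y.1)
    (fun i => regularAt_apply i) (hF.div hG trivial hG0) regularAt_fst rfl (by simp [hF0]) rfl
    ?_ (Eventually.of_forall fun _ _ => rfl) (Eventually.of_forall fun _ _ _ _ _ => rfl)
    fun h => ?_
  · filter_upwards [hG.eventually_ne hG0] with x hx
    exact (div_mul_cancel₀ _ hx).symm
  · rw [zariskiNhds_eq_within] at h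
    exact hG0 (h.self_of_zariskiNhdsWithin trivial)

/-- Suppose that, up to units, `(F, G) = (f, g + κ f)`, and that near `0` the ideal `(f, g)`
contains the equation `ℓ - α` of a graph over a complement of the line `ℂ v`. Write `ξ x` for the
point of the graph on the line `x + ℂ v`, and `R = g ∘ ξ`. Since `f (ξ x)` is a multiple of `R x`,
the ideal `(f, g)` is `(ℓ - α, R)`, where `R` does not depend on the coordinate `ℓ`. The blowup of
this ideal has the chart `ℓ = α + t R`, and `t`, shifted by a constant, replaces `ℓ` as a coordinate
on affine space. -/
theorem germIso_localBlowup_of_elimination {n : ℕ} {U : Set (Fin n → ℂ)}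
    (hU : IsOpen[zariski (Fin n → ℂ)] U) (h0U : (0 : Fin n → ℂ) ∈ U) {F G : (Fin n → ℂ) → ℂ}
    (hG : RegularAt Set.univ G 0) {f g e e' : (Fin n → ℂ) → ℂ} {κ : ℂ}
    (hg : RegularAt Set.univ g 0) (he : RegularAt Set.univ e 0) (he' : RegularAt Set.univ e' 0)
    (he0 : e 0 ≠ 0) (he'0 : e' 0 ≠ 0) (hFe : ∀ᶠ x in zariskiNhds n, F x = e x * f x)
    (hGe : ∀ᶠ x in zariskiNhds n, G x = e' x * (g x + κ * f x))
    {v : Fin n → ℂ} {ℓ : (Fin n → ℂ) →ₗ[ℂ] ℂ} (hℓr : RegularAt Set.univ (fun x => ℓ x) 0)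
    (hℓ : ℓ v = 1) {α a b f₁ g₁ : (Fin n → ℂ) → ℂ} (hα : RegularAt Set.univ α 0)
    (ha : RegularAt Set.univ a 0) (hb : RegularAt Set.univ b 0) (hf₁ : RegularAt Set.univ f₁ 0)
    (hg₁ : RegularAt Set.univ g₁ 0) (hαv : ∀ x (T : ℂ), α (x + T • v) = α x) (hα0 : α 0 = 0)
    (haf : a 0 * f₁ 0 = 1) (hg₁0 : g₁ 0 = 0) (hg0 : g 0 = 0)
    (hlin : ∀ᶠ x in zariskiNhds n, ℓ x - α x = a x * f x + b x * g x)
    (hf : ∀ x, f x - f (x + (α x - ℓ x) • v) = (ℓ x - α x) * f₁ x)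
    (hg' : ∀ x, g x - g (x + (α x - ℓ x) • v) = (ℓ x - α x) * g₁ x)
    (hR : ¬ ∀ᶠ x in zariskiNhds n, g (x + (α x - ℓ x) • v) = 0) :
    ((0 : Fin n → ℂ), zeroOne) ∈ localBlowup U F G ∧
      GermIso (localBlowup U F G) ((0 : Fin n → ℂ), zeroOne)
        (Set.univ : Set (Fin n → ℂ)) 0 := by
  have ha0 : a 0 ≠ 0 := left_ne_zero_of_mul_eq_one haf
  have hcoord : ∀ {c : (Fin n → ℂ) → ℂ}, RegularAt Set.univ c 0 →
      ∀ i, RegularAt Set.univ (fun x => (x + c x • v) i) 0 :=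
    fun hc i => (regularAt_apply i).add (hc.mul (regularAt_const (v i)))
  -- the base point has `t = b 0`, whence the shift
  let ξ : (Fin n → ℂ) → Fin n → ℂ := fun x => x + (α x - ℓ x) • v
  let R : (Fin n → ℂ) → ℂ := fun x => g (ξ x)
  let t : (Fin n → ℂ) → ℂ := fun w => ℓ w + b 0
  let Φ : (Fin n → ℂ) → Fin n → ℂ := fun w => w + (α w + t w * R w - ℓ w) • v
  let β : (Fin n → ℂ) → ℂ := fun w => -b (ξ w) / a (ξ w)
  let σ₀ : (Fin n → ℂ) → ℂ := fun w => (β w + t w * f₁ (Φ w)) / (1 + t w * g₁ (Φ w))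
  let σ : (Fin n → ℂ) → ℂ := fun w => e (Φ w) * σ₀ w / (e' (Φ w) * (1 + κ * σ₀ w))
  let s₁ : (Fin n → ℂ) × ProjLine → ℂ := fun y => affineCoord y.2 * e' y.1 / e y.1
  let s₀ : (Fin n → ℂ) × ProjLine → ℂ := fun y => s₁ y / (1 - κ * s₁ y)
  let q : (Fin n → ℂ) × ProjLine → ℂ := fun y => a y.1 * s₀ y + b y.1
  let T : (Fin n → ℂ) × ProjLine → ℂ := fun y => q y / (1 - q y * g₁ y.1)
  let τ : (Fin n → ℂ) × ProjLine → Fin n → ℂ := fun y => y.1 + (T y - b 0 - ℓ y.1) • v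
  -- values at the base points
  have hξ0 : ξ 0 = 0 := by simp [ξ, hα0]
  have hR0 : R 0 = 0 := by simp [R, hξ0, hg0]
  have ht0 : t 0 = b 0 := by simp [t]
  have hΦ0 : Φ 0 = 0 := by simp [Φ, hα0, hR0]
  have hσ₀0 : σ₀ 0 = 0 := by
    simp only [σ₀, β, hξ0, hΦ0, ht0, hg₁0]
    field_simp
    linear_combination b 0 * haf
  have hσ0 : σ 0 = 0 := by simp [σ, hσ₀0]
  have hslope : affineCoord zeroOne = 0 := affineCoord_affinePoint 0
  have hs₁0 : s₁ (0, zeroOne) = 0 := by simp [s₁, hslope]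
  have hs₀0 : s₀ (0, zeroOne) = 0 := by simp [s₀, hs₁0]
  have hτ0 : τ (0, zeroOne) = 0 := by simp [τ, T, q, hs₀0, hg₁0]
  -- regularity at the base points
  have hξr : ∀ i, RegularAt Set.univ (fun x => ξ x i) 0 := hcoord (hα.sub hℓr)
  have hRr : RegularAt Set.univ R 0 := hg.comp hξ0 (Set.mem_univ _) hξr
  have htr : RegularAt Set.univ t 0 := hℓr.add (regularAt_const _)
  have hΦr : ∀ i, RegularAt Set.univ (fun x => Φ x i) 0 :=
    hcoord ((hα.add (htr.mul hRr)).sub hℓr)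
  have haξ : RegularAt Set.univ (fun w => a (ξ w)) 0 := ha.comp hξ0 (Set.mem_univ _) hξr
  have hdr : RegularAt Set.univ (fun w => 1 + t w * g₁ (Φ w)) 0 :=
    (regularAt_const 1).add (htr.mul (hg₁.comp hΦ0 (Set.mem_univ _) hΦr))
  have hd0 : 1 + t 0 * g₁ (Φ 0) ≠ 0 := by simp [hΦ0, hg₁0]
  have hσ₀r : RegularAt Set.univ σ₀ 0 := by
    refine RegularAt.div (RegularAt.add ?_ (htr.mul (hf₁.comp hΦ0 (Set.mem_univ _) hΦr))) hdr trivial hd0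
    exact (hb.comp hξ0 (Set.mem_univ _) hξr).neg.div haξ trivial (by rwa [hξ0])
  have hκr : RegularAt Set.univ (fun w => 1 + κ * σ₀ w) 0 :=
    (regularAt_const 1).add ((regularAt_const κ).mul hσ₀r)
  have hκ0 : 1 + κ * σ₀ 0 ≠ 0 := by simp [hσ₀0]
  have hσr : RegularAt Set.univ σ 0 := by
    refine ((he.comp hΦ0 (Set.mem_univ _) hΦr).mul hσ₀r).div
      ((he'.comp hΦ0 (Set.mem_univ _) hΦr).mul hκr) trivial (mul_ne_zero ?_ hκ0)
    rwa [hΦ0]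
  have hfst : ∀ {h : (Fin n → ℂ) → ℂ}, RegularAt Set.univ h 0 → RegularAt Set.univ
      (fun y : (Fin n → ℂ) × ProjLine => h y.1) (0, zeroOne) :=
    fun hh => hh.comp rfl trivial regularAt_fst
  have hs₁r : RegularAt Set.univ s₁ (0, zeroOne) :=
    ((regularAt_affineCoord (rep_affinePoint_ne_zero 0)).mul (hfst he')).div (hfst he) trivial he0
  have hk₁r : RegularAt Set.univ (fun y => 1 - κ * s₁ y) (0, zeroOne) :=
    (regularAt_const 1).sub ((regularAt_const κ).mul hs₁r)
  have hk₁0 : 1 - κ * s₁ (0, zeroOne) ≠ 0 := by simp [hs₁0]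
  have hqr : RegularAt Set.univ q (0, zeroOne) :=
    ((hfst ha).mul (hs₁r.div hk₁r trivial hk₁0)).add (hfst hb)
  have hq₁r : RegularAt Set.univ (fun y => 1 - q y * g₁ y.1) (0, zeroOne) :=
    (regularAt_const 1).sub (hqr.mul (hfst hg₁))
  have hq₁0 : 1 - q (0, zeroOne) * g₁ 0 ≠ 0 := by simp [hg₁0]
  have hτr : ∀ i, RegularAt Set.univ (fun y => τ y i) (0, zeroOne) := fun i =>
    (regularAt_fst i).add ((((hqr.div hq₁r trivial hq₁0).sub (regularAt_const _)).sub
      (hfst hℓr)).mul (regularAt_const (v i)))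
  -- `ξ` is constant along `v`
  have hℓv : ∀ x (c : ℂ), ℓ (x + c • v) = ℓ x + c := fun x c => by simp [hℓ]
  have hξv : ∀ x (c : ℂ), ξ (x + c • v) = ξ x := by
    intro x c
    simp only [ξ, hαv, hℓv, add_assoc, ← add_smul]
    congr 2
    ring
  have hℓΦ : ∀ w, ℓ (Φ w) - α (Φ w) = t w * R w := by
    intro w
    simp only [Φ, hαv, hℓv]
    ring
  have hgΦ : ∀ w, g (Φ w) = R w * (1 + t w * g₁ (Φ w)) := by
    intro w
    have h := hg' (Φ w)
    rw [hℓΦ, show Φ w + (α (Φ w) - ℓ (Φ w)) • v = ξ w from hξv _ _] at h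
    linear_combination h
  have hfΦ : ∀ᶠ w in zariskiNhds n, f (Φ w) = σ₀ w * g (Φ w) := by
    filter_upwards [(tendsto_zariskiNhds hξ0 hξr).eventually hlin,
      haξ.eventually_ne (by rwa [hξ0]), hdr.eventually_ne hd0] with w hw haw hdw
    have h := hf (Φ w)
    rw [hℓΦ, show Φ w + (α (Φ w) - ℓ (Φ w)) • v = ξ w from hξv _ _] at h
    have hℓξ : ℓ (ξ w) - α (ξ w) = 0 := by
      simp only [ξ, hαv, hℓv]
      ring
    have hβ : f (ξ w) = β w * R w := by
      simp only [β, R]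
      field_simp
      linear_combination hℓξ - hw
    have hσw : σ₀ w * (1 + t w * g₁ (Φ w)) = β w + t w * f₁ (Φ w) := div_mul_cancel₀ _ hdw
    rw [hgΦ]
    linear_combination h + hβ - R w * hσw
  have hΦt := tendsto_zariskiNhds hΦ0 hΦr
  have hGΦ : ∀ᶠ w in zariskiNhds n, G (Φ w) =
      R w * (e' (Φ w) * (1 + t w * g₁ (Φ w)) * (1 + κ * σ₀ w)) := by
    filter_upwards [hΦt.eventually hGe, hfΦ] with w hw hfw
    rw [hw, hfw, hgΦ]
    ring
  have heΦ := hΦt.eventually (he.eventually_ne he0)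
  have he'Φ := hΦt.eventually (he'.eventually_ne he'0)
  refine germIso_of_chart hU h0U hG hΦr hσr hτr hΦ0 hσ0 hτ0 ?_ ?_ ?_ ?_
  · filter_upwards [hGΦ, hΦt.eventually hFe, hfΦ, he'Φ, hκr.eventually_ne hκ0]
      with w hGw hFw hfw hew hκw
    have hσw : σ w * (e' (Φ w) * (1 + κ * σ₀ w)) = e (Φ w) * σ₀ w :=
      div_mul_cancel₀ _ (mul_ne_zero hew hκw)
    rw [hFw, hGw, hfw, hgΦ]
    linear_combination -(R w * (1 + t w * g₁ (Φ w))) * hσw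
  · filter_upwards [hGΦ, hΦt.eventually hlin, hfΦ, heΦ, he'Φ, hκr.eventually_ne hκ0]
      with w hGw hlw hfw hew he'w hκw hne
    have hRw : R w ≠ 0 := fun h => hne (by rw [hGw, h, zero_mul])
    set y : (Fin n → ℂ) × ProjLine := (Φ w, affinePoint (σ w)) with hy
    have hs₁ : s₁ y = σ₀ w / (1 + κ * σ₀ w) := by
      simp only [s₁, hy, affineCoord_affinePoint, σ]
      field_simp
    have hs₀ : s₀ y = σ₀ w := by
      have : 1 - κ * s₁ y = 1 / (1 + κ * σ₀ w) := by
        rw [hs₁]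
        field_simp
        ring
      rw [show s₀ y = s₁ y / (1 - κ * s₁ y) from rfl, this, hs₁, div_div_div_cancel_right₀ hκw,
        div_one]
    have hqy : q y = a (Φ w) * σ₀ w + b (Φ w) := by
      rw [← hs₀]
    have htq : t w = q y * (1 + t w * g₁ (Φ w)) := by
      refine mul_right_cancel₀ hRw ?_
      rw [← hℓΦ, hlw, hfw, hgΦ, hqy]
      ring
    have hden : 1 - q y * g₁ (Φ w) ≠ 0 := by
      intro h0
      have hq0 : q y = 0 := by linear_combination t w * h0 - htq
      rw [hq0] at h0
      simp at h0
    have hT : T y = t w := by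
      simp only [T, hy]
      rw [div_eq_iff hden]
      linear_combination -htq
    simp only [τ, hT]
    simp only [hy, Φ, hℓv, t, add_assoc, ← add_smul]
    rw [add_eq_left]
    convert zero_smul ℂ v using 2
    ring
  · have hfstt := tendsto_fst_zariskiNhds n
    filter_upwards [hfstt.eventually (he.eventually_ne he0), hfstt.eventually hFe,
      hfstt.eventually hGe, hfstt.eventually hlin, hk₁r.eventually_ne_zero trivial hk₁0,
      hq₁r.eventually_ne_zero trivial hq₁0] with y hey hFy hGy hly hky hqy s hys hFG _
    have hs₁ : s₁ y * e y.1 = s * e' y.1 := by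
      simp only [s₁, hys, affineCoord_affinePoint]
      field_simp
    have hfs₁ : f y.1 = s₁ y * (g y.1 + κ * f y.1) := by
      refine mul_left_cancel₀ hey ?_
      rw [← hFy, hFG, hGy]
      linear_combination -(g y.1 + κ * f y.1) * hs₁
    have hs₀ : s₀ y * (1 - κ * s₁ y) = s₁ y := div_mul_cancel₀ _ hky
    have hfs₀ : f y.1 = s₀ y * g y.1 := by
      refine mul_right_cancel₀ hky ?_
      linear_combination hfs₁ - g y.1 * hs₀
    have hTy : T y * (1 - q y * g₁ y.1) = q y := div_mul_cancel₀ _ hqy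
    have hgy : g y.1 - R y.1 = (ℓ y.1 - α y.1) * g₁ y.1 := hg' y.1
    have hlT : ℓ y.1 - α y.1 = T y * R y.1 := by
      refine mul_right_cancel₀ hqy ?_
      have hlq : ℓ y.1 - α y.1 = q y * g y.1 := by
        simp only [q]
        linear_combination hly + a y.1 * hfs₀
      linear_combination hlq + q y * hgy - R y.1 * hTy
    have hRτ : R (τ y) = R y.1 := by simp only [R, τ, hξv]
    have hατ : α (τ y) = α y.1 := by simp only [τ, hαv]
    have hℓτ : ℓ (τ y) = T y - b 0 := by
      simp only [τ, hℓv]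
      ring
    simp only [Φ, t, hRτ, hατ, hℓτ]
    simp only [τ, add_assoc, ← add_smul]
    rw [add_eq_left]
    convert zero_smul ℂ v using 2
    linear_combination -hlT
  · intro h
    refine hR ?_
    filter_upwards [h, hGΦ, he'Φ, hdr.eventually_ne hd0, hκr.eventually_ne hκ0]
      with w hw hGw hew hdw hκw
    rw [hGw] at hw
    exact (mul_eq_zero.1 hw).resolve_right (mul_ne_zero (mul_ne_zero hew hdw) hκw)

/-! ### Polynomials along a line as regular functions -/

section Line

variable {n : ℕ}

/-- The difference quotient `(h(y, T) - h(y, T')) / (T - T')` of `h ∈ ℂ[y][T]`, as a polynomial. -/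
noncomputable def lineQuotient (h : Polynomial (MvPolynomial (Fin n) ℂ)) (y : Fin n → ℂ)
    (T T' : ℂ) : ℂ :=
  ∑ k ∈ Finset.range (h.natDegree + 2),
    MvPolynomial.eval y (h.coeff k) * ∑ i ∈ Finset.range k, T ^ i * T' ^ (k - 1 - i)

theorem evalLine_eq_sum (h : Polynomial (MvPolynomial (Fin n) ℂ)) (y : Fin n → ℂ) (T : ℂ) :
    evalLine y T h =
      ∑ k ∈ Finset.range (h.natDegree + 2), MvPolynomial.eval y (h.coeff k) * T ^ k :=
  Polynomial.eval₂_eq_sum_range' _ (by omega) _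

theorem evalLine_sub_evalLine (h : Polynomial (MvPolynomial (Fin n) ℂ)) (y : Fin n → ℂ)
    (T T' : ℂ) : evalLine y T h - evalLine y T' h = (T - T') * lineQuotient h y T T' := by
  rw [evalLine_eq_sum, evalLine_eq_sum, lineQuotient, ← Finset.sum_sub_distrib, Finset.mul_sum]
  refine Finset.sum_congr rfl fun k _ => ?_
  rw [← mul_sub, ← (Commute.all T T').geom_sum₂_mul]
  ring

theorem lineQuotient_zero (h : Polynomial (MvPolynomial (Fin n) ℂ)) (y : Fin n → ℂ) :
    lineQuotient h y 0 0 = MvPolynomial.eval y (h.coeff 1) := by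
  rw [lineQuotient, Finset.sum_eq_single_of_mem 1 (by simp)]
  · simp
  · intro k _ hk
    rw [Finset.sum_eq_zero, mul_zero]
    intro i hi
    have := Finset.mem_range.1 hi
    rcases Nat.eq_zero_or_pos i with rfl | hi0
    · rw [zero_pow (show k - 1 - 0 ≠ 0 by omega), mul_zero]
    · rw [zero_pow hi0.ne', zero_mul]

theorem RegularAt.lineQuotient {X : Type} [HasFractions X] [FractionLaws X] {S : Set X} {a : X}
    {y : X → Fin n → ℂ} {T T' : X → ℂ} (hy : ∀ i, RegularAt S (fun x => y x i) a)
    (hT : RegularAt S T a) (hT' : RegularAt S T' a) (h : Polynomial (MvPolynomial (Fin n) ℂ)) :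
    RegularAt S (fun x => lineQuotient h (y x) (T x) (T' x)) a :=
  RegularAt.sum _ fun _ _ => (RegularAt.eval hy _).mul
    (RegularAt.sum _ fun _ _ => (hT.pow _).mul (hT'.pow _))

theorem RegularAt.evalLine {X : Type} [HasFractions X] [FractionLaws X] {S : Set X} {a : X}
    {y : X → Fin n → ℂ} {T : X → ℂ} (hy : ∀ i, RegularAt S (fun x => y x i) a)
    (hT : RegularAt S T a) (h : Polynomial (MvPolynomial (Fin n) ℂ)) :
    RegularAt S (fun x => evalLine (y x) (T x) h) a := by
  simp only [evalLine_eq_sum]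
  exact RegularAt.sum _ fun _ _ => (RegularAt.eval hy _).mul (hT.pow _)

theorem evalLine_zero_zero (h : Polynomial (MvPolynomial (Fin n) ℂ)) :
    evalLine 0 0 h = (h.map (MvPolynomial.eval 0)).coeff 0 := by
  rw [Polynomial.coeff_zero_eq_eval_zero, Polynomial.eval_map]
  rfl

theorem differentiableAt_eval (p : MvPolynomial (Fin n) ℂ) (x : Fin n → ℂ) :
    DifferentiableAt ℂ (fun x => MvPolynomial.eval x p) x := by
  have h := AnalyticAt.aeval_mvPolynomial (𝕜 := ℂ) (A := ℂ) (B := ℂ) (z := x)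
    (f := fun x : Fin n → ℂ => x)
    (fun i => (ContinuousLinearMap.proj (R := ℂ) (φ := fun _ : Fin n => ℂ) i).analyticAt x) p
  exact h.differentiableAt

theorem coeff_one_restrictLine (v : Fin n → ℂ) (p : MvPolynomial (Fin n) ℂ) :
    (restrictLine v p).coeff 1 = fderiv ℂ (fun x => MvPolynomial.eval x p) 0 v := by
  have h1 : HasDerivAt (fun T : ℂ => T • v) v 0 := by
    simpa using (hasDerivAt_id (0 : ℂ)).smul_const v
  have h2 : HasFDerivAt (fun x => MvPolynomial.eval x p)
      (fderiv ℂ (fun x => MvPolynomial.eval x p) 0) ((0 : ℂ) • v) := by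
    rw [zero_smul]
    exact (differentiableAt_eval p 0).hasFDerivAt
  have h3 := h2.comp_hasDerivAt (0 : ℂ) h1
  have h4 := (restrictLine v p).hasDerivAt 0
  rw [← Polynomial.coeff_zero_eq_eval_zero, Polynomial.coeff_derivative] at h4
  have h5 : (fun x => MvPolynomial.eval x p) ∘ (fun T : ℂ => T • v) =
      fun T => (restrictLine v p).eval T := funext fun T => (eval_restrictLine v p T).symm
  rw [h5] at h3
  simpa using h4.unique h3

/-- A nonzero polynomial and a nonzero linear form are simultaneously nonzero at some vector. -/
theorem exists_eval_ne_zero_and_ne_zero {D : MvPolynomial (Fin n) ℂ} (hD : D ≠ 0)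
    {L : (Fin n → ℂ) →L[ℂ] ℂ} (hL : L ≠ 0) : ∃ v, MvPolynomial.eval v D ≠ 0 ∧ L v ≠ 0 := by
  let Λ : MvPolynomial (Fin n) ℂ :=
    ∑ i, MvPolynomial.C (L (Pi.single i 1)) * MvPolynomial.X i
  have hΛ : ∀ v, MvPolynomial.eval v Λ = L v := by
    intro v
    conv_rhs => rw [pi_eq_sum_univ' v]
    simp [Λ, mul_comm]
  have hΛ0 : Λ ≠ 0 := by
    rintro h0
    refine hL (ContinuousLinearMap.ext fun v => ?_)
    rw [← hΛ, h0, map_zero, zero_apply]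
  by_contra! H
  refine mul_ne_zero hD hΛ0 (MvPolynomial.funext fun v => ?_)
  rw [map_mul, map_zero, hΛ]
  by_cases hv : MvPolynomial.eval v D = 0
  · rw [hv, zero_mul]
  · rw [H v hv, mul_zero]

theorem exists_prime_dvd_eval_eq_zero {P : MvPolynomial (Fin n) ℂ} (hP : P ≠ 0)
    {x : Fin n → ℂ} (hx : MvPolynomial.eval x P = 0) :
    ∃ p, Prime p ∧ p ∣ P ∧ MvPolynomial.eval x p = 0 := by
  induction P using UniqueFactorizationMonoid.induction_on_prime with
  | h₁ => exact absurd rfl hP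
  | h₂ u hu => exact absurd hx (hu.map (MvPolynomial.eval x)).ne_zero
  | h₃ a p ha hp ih =>
    rw [map_mul, mul_eq_zero] at hx
    rcases hx with hx | hx
    · exact ⟨p, hp, dvd_mul_right p a, hx⟩
    · obtain ⟨p', hp', hdvd, h0⟩ := ih ha hx
      exact ⟨p', hp', hdvd.mul_left p, h0⟩

end Line

/-! ### Existence of the chart -/

/-- The blowup of `(e p, e' h)` for units `e`, `e'`, where `p` is a prime polynomial with nonzero
derivative at `0` and `h` is a polynomial vanishing at `0`, if `p` does not divide `h` locally. -/
theorem germIso_localBlowup_of_prime {n : ℕ} {U : Set (Fin n → ℂ)}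
    (hU : IsOpen[zariski (Fin n → ℂ)] U) (h0U : (0 : Fin n → ℂ) ∈ U) {F G : (Fin n → ℂ) → ℂ}
    (hG : RegularAt Set.univ G 0)
    (hFG : ∀ q, RegularAt Set.univ q 0 → ¬ ∀ᶠ x in zariskiNhds n, G x = F x * q x)
    {e e' : (Fin n → ℂ) → ℂ} (he : RegularAt Set.univ e 0) (he' : RegularAt Set.univ e' 0)
    (he0 : e 0 ≠ 0) (he'0 : e' 0 ≠ 0) {p h : MvPolynomial (Fin n) ℂ}
    (hFe : ∀ᶠ x in zariskiNhds n, F x = e x * MvPolynomial.eval x p)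
    (hGe : ∀ᶠ x in zariskiNhds n, G x = e' x * MvPolynomial.eval x h)
    (hp : Prime p) (hp0 : MvPolynomial.eval 0 p = 0) (hh0 : MvPolynomial.eval 0 h = 0)
    (hp' : fderiv ℂ (fun x => MvPolynomial.eval x p) 0 ≠ 0) :
    ((0 : Fin n → ℂ), zeroOne) ∈ localBlowup U F G ∧
      GermIso (localBlowup U F G) ((0 : Fin n → ℂ), zeroOne)
        (Set.univ : Set (Fin n → ℂ)) 0 := by
  have hpoly : ∀ q : MvPolynomial (Fin n) ℂ,
      RegularAt Set.univ (fun x => MvPolynomial.eval x q) (0 : Fin n → ℂ) :=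
    fun q => RegularAt.eval (fun i => regularAt_apply i) q
  have heq : ∀ᶠ x in zariskiNhds n, e x ≠ 0 := he.eventually_ne he0
  have hph : ¬ p ∣ h := by
    rintro ⟨q, rfl⟩
    refine hFG _ ((he'.mul (hpoly q)).div he trivial he0) ?_
    filter_upwards [hFe, hGe, heq] with x hFx hGx hex
    rw [hFx, hGx, map_mul]
    field_simp
  obtain ⟨D, k, hD, hDk, hD0⟩ := exists_isHomogeneous_mem_span_pair hp hph
  obtain ⟨v, hDv, hLv⟩ := exists_eval_ne_zero_and_ne_zero hD0 hp'
  set L := fderiv ℂ (fun x => MvPolynomial.eval x p) 0 with hL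
  -- subtracting a multiple of `p` makes the second polynomial critical along `v`
  set κ : ℂ := (restrictLine v h).coeff 1 / L v with hκ
  set g : MvPolynomial (Fin n) ℂ := h - MvPolynomial.C κ * p with hg
  have hp1 : (restrictLine v p).coeff 1 = L v := coeff_one_restrictLine v p
  have hg1 : (restrictLine v g).coeff 1 = 0 := by
    have : restrictLine v g = restrictLine v h - Polynomial.C κ * restrictLine v p := by
      refine Polynomial.funext fun T => ?_
      simp only [Polynomial.eval_sub, Polynomial.eval_mul, Polynomial.eval_C, eval_restrictLine, hg,
        map_sub, map_mul, MvPolynomial.eval_C]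
    rw [this, Polynomial.coeff_sub, Polynomial.coeff_C_mul, hp1, hκ, div_mul_cancel₀ _ hLv,
      sub_self]
  have hg0 : MvPolynomial.eval 0 g = 0 := by
    rw [hg, map_sub, map_mul, hp0, hh0, mul_zero, sub_zero]
  have hDg : D ∈ Ideal.span {p, g} := by
    obtain ⟨a, b, rfl⟩ := Ideal.mem_span_pair.1 hD
    exact Ideal.mem_span_pair.2 ⟨a + b * MvPolynomial.C κ, b, by rw [hg]; ring⟩
  obtain ⟨r, q, a, b, hr, hab⟩ := exists_linear_mem_span_pair hDg hDk hDv hp0 (hp1 ▸ hLv)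
  let ℓ : (Fin n → ℂ) →ₗ[ℂ] ℂ := (L v)⁻¹ • (L : (Fin n → ℂ) →ₗ[ℂ] ℂ)
  have hℓ : ℓ v = 1 := inv_mul_cancel₀ hLv
  have hℓr : RegularAt Set.univ (fun x => ℓ x) (0 : Fin n → ℂ) := by
    have : ∀ x, ℓ x = ∑ i, x i * ℓ (Pi.single i 1) := by
      intro x
      conv_lhs => rw [pi_eq_sum_univ' x]
      simp only [map_sum, map_smul, smul_eq_mul]
    exact (RegularAt.sum _ fun i _ => (regularAt_apply i).mul (regularAt_const _)).congr
      (Eventually.of_forall this)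
  -- the projection along `v`
  let π : (Fin n → ℂ) → Fin n → ℂ := fun x => x - ℓ x • v
  have hπ0 : π 0 = 0 := by simp [π]
  have hπr : ∀ i, RegularAt Set.univ (fun x => π x i) 0 := fun i =>
    (regularAt_apply i).sub (hℓr.mul (regularAt_const (v i)))
  have hπv : ∀ x (T : ℂ), π (x + T • v) = π x := by
    intro x T
    simp only [π, map_add, map_smul, hℓ, smul_eq_mul, mul_one, add_smul]
    abel
  have hπℓ : ∀ x, π x + ℓ x • v = x := fun x => sub_add_cancel _ _
  let α : (Fin n → ℂ) → ℂ := fun x => MvPolynomial.eval (π x) q / MvPolynomial.eval (π x) r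
  have hrr : RegularAt Set.univ (fun x => MvPolynomial.eval (π x) r) 0 := RegularAt.eval hπr r
  have hr0 : MvPolynomial.eval (π 0) r ≠ 0 := by
    rw [hπ0, hr]
    exact one_ne_zero
  have hα : RegularAt Set.univ α 0 := (RegularAt.eval hπr q).div hrr trivial hr0
  have hline : ∀ (y : Fin n → ℂ) (T : ℂ), MvPolynomial.eval y r * T - MvPolynomial.eval y q =
      evalLine y T a * MvPolynomial.eval (y + T • v) p +
        evalLine y T b * MvPolynomial.eval (y + T • v) g := by
    intro y T
    have := congrArg (evalLine y T) hab
    rw [map_sub, map_mul, map_add, map_mul, map_mul, evalLine_lineHom, evalLine_lineHom] at this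
    simpa [evalLine] using this
  have hα0 : α 0 = 0 := by
    have := hline 0 0
    rw [zero_smul, add_zero, hp0, hg0] at this
    have hq : MvPolynomial.eval 0 q = 0 := by linear_combination -this
    simp only [α, hπ0, hq, zero_div]
  have hafr : evalLine 0 0 a * L v = 1 := by
    have := congrArg (fun z => (z.map (MvPolynomial.eval (0 : Fin n → ℂ))).coeff 1) hab
    simp only [Polynomial.map_sub, Polynomial.map_mul, Polynomial.map_add, Polynomial.map_C,
      Polynomial.map_X, Polynomial.coeff_sub, Polynomial.coeff_add,
      Polynomial.coeff_X_one, Polynomial.mul_coeff_one] at this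
    change _ = _ * (restrictLine v p).coeff 1 + _ * (restrictLine v p).coeff 0 +
      (_ * (restrictLine v g).coeff 1 + _ * (restrictLine v g).coeff 0) at this
    rw [hr, hp1, hg1, coeff_zero_restrictLine, coeff_zero_restrictLine, hp0, hg0,
      ← evalLine_zero_zero] at this
    simpa [Polynomial.coeff_C] using this.symm
  have hquot : ∀ (u : MvPolynomial (Fin n) ℂ) x, MvPolynomial.eval x u -
      MvPolynomial.eval (x + (α x - ℓ x) • v) u =
        (ℓ x - α x) * lineQuotient (lineHom v u) (π x) (ℓ x) (α x) := by
    intro u x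
    rw [← evalLine_sub_evalLine, evalLine_lineHom, evalLine_lineHom, hπℓ]
    congr 3
    simp only [π, sub_smul]
    abel
  have hquotr : ∀ u : MvPolynomial (Fin n) ℂ, RegularAt Set.univ
      (fun x => lineQuotient (lineHom v u) (π x) (ℓ x) (α x)) 0 :=
    fun u => RegularAt.lineQuotient hπr hℓr hα _
  have hquot0 : ∀ u : MvPolynomial (Fin n) ℂ,
      lineQuotient (lineHom v u) (π 0) (ℓ 0) (α 0) = (restrictLine v u).coeff 1 := by
    intro u
    rw [hα0, map_zero, lineQuotient_zero, hπ0, restrictLine, Polynomial.coeff_map]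
  have hlin : ∀ᶠ x in zariskiNhds n, ℓ x - α x =
      evalLine (π x) (ℓ x) a / MvPolynomial.eval (π x) r * MvPolynomial.eval x p +
        evalLine (π x) (ℓ x) b / MvPolynomial.eval (π x) r * MvPolynomial.eval x g := by
    filter_upwards [hrr.eventually_ne hr0] with x hx
    have h1 := hline (π x) (ℓ x)
    rw [hπℓ] at h1
    have h2 : α x * MvPolynomial.eval (π x) r = MvPolynomial.eval (π x) q := div_mul_cancel₀ _ hx
    field_simp
    linear_combination h1 - h2
  have har : RegularAt Set.univ
      (fun x => evalLine (π x) (ℓ x) a / MvPolynomial.eval (π x) r) 0 :=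
    (RegularAt.evalLine hπr hℓr a).div hrr trivial hr0
  refine germIso_localBlowup_of_elimination hU h0U hG (hpoly g) he he' he0 he'0 hFe (κ := κ)
    ?_ hℓr hℓ hα har ((RegularAt.evalLine hπr hℓr b).div hrr trivial hr0) (hquotr p) (hquotr g)
    (fun x T => by simp only [α, hπv]) hα0 ?_ ((hquot0 g).trans hg1) hg0 hlin (hquot p) (hquot g) ?_
  · filter_upwards [hGe] with x hx
    rw [hx, hg]
    simp
  · rw [hquot0, hp1, hπ0, map_zero, hr, div_one, hafr]
  -- if `g` vanished on the graph of `α`, both `p` and `g` would be multiples of `ℓ - α`, the first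
  -- of them with a unit cofactor
  · intro hR
    have hξr : ∀ i, RegularAt Set.univ (fun x => (x + (α x - ℓ x) • v) i) 0 := fun i =>
      (regularAt_apply i).add ((hα.sub hℓr).mul (regularAt_const (v i)))
    have hξ0 : (0 : Fin n → ℂ) + (α 0 - ℓ 0) • v = 0 := by simp [hα0]
    set f₁ : (Fin n → ℂ) → ℂ := fun x => lineQuotient (lineHom v p) (π x) (ℓ x) (α x)
    have hf₁0 : f₁ 0 ≠ 0 := by
      rw [show f₁ 0 = L v from (hquot0 p).trans hp1]
      exact hLv
    have ha0 : evalLine (π 0) (ℓ 0) a / MvPolynomial.eval (π 0) r ≠ 0 := by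
      rw [hπ0, map_zero, hr, div_one]
      exact left_ne_zero_of_mul_eq_one hafr
    have hpξ : ∀ᶠ x in zariskiNhds n, MvPolynomial.eval (x + (α x - ℓ x) • v) p = 0 := by
      filter_upwards [(tendsto_zariskiNhds hξ0 hξr).eventually hlin,
        (tendsto_zariskiNhds hξ0 hξr).eventually (har.eventually_ne ha0), hR] with x hx hax hRx
      rw [hRx, mul_zero, add_zero] at hx
      have hℓξ : ℓ (x + (α x - ℓ x) • v) - α (x + (α x - ℓ x) • v) = 0 := by
        simp only [α, hπv, map_add, map_smul, hℓ, smul_eq_mul]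
        ring
      rw [hℓξ] at hx
      exact (mul_eq_zero.1 hx.symm).resolve_left hax
    refine hFG (fun x => e' x * (lineQuotient (lineHom v g) (π x) (ℓ x) (α x) + κ * f₁ x) /
      (e x * f₁ x)) ?_ ?_
    · exact (he'.mul ((hquotr g).add ((regularAt_const κ).mul (hquotr p)))).div
        (he.mul (hquotr p)) trivial (mul_ne_zero he0 hf₁0)
    · filter_upwards [hFe, hGe, heq, hpξ, hR, (hquotr p).eventually_ne hf₁0]
        with x hFx hGx hex hpx hRx hf₁x
      have h1 := hquot p x
      have h2 := hquot g x
      rw [hpx, sub_zero] at h1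
      rw [hRx, sub_zero] at h2
      have h3 : MvPolynomial.eval x h = MvPolynomial.eval x g + κ * MvPolynomial.eval x p := by
        simp [hg]
      have hf₁x' : f₁ x ≠ 0 := hf₁x
      rw [hFx, hGx, h3, h2, h1]
      change _ = e x * ((ℓ x - α x) * f₁ x) * (_ / _)
      rw [mul_div_assoc', eq_div_iff (mul_ne_zero hex hf₁x')]
      ring

theorem mainTheorem5 (n : ℕ) (f g : regularGerms n)
    (hf : germValue (f : Germ (zariskiNhds n) ℂ) = 0)
    (hf' : germDeriv (f : Germ (zariskiNhds n) ℂ) ≠ 0)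
    (hfg : ¬ f ∣ g)
    (U : Set (Fin n → ℂ)) (hU : IsOpen[zariski (Fin n → ℂ)] U) (h0U : (0 : Fin n → ℂ) ∈ U)
    (F G : (Fin n → ℂ) → ℂ) (hF : RegularOn U F) (hG : RegularOn U G)
    (hFf : (F : Germ (zariskiNhds n) ℂ) = f) (hGg : (G : Germ (zariskiNhds n) ℂ) = g) :
    ((0 : Fin n → ℂ), zeroOne) ∈ localBlowup U F G ∧
      GermIso (localBlowup U F G) ((0 : Fin n → ℂ), zeroOne)
        (Set.univ : Set (Fin n → ℂ)) 0 := by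
  have hFr : RegularAt Set.univ F 0 := (hF 0 h0U).of_isOpen hU h0U
  have hGr : RegularAt Set.univ G 0 := (hG 0 h0U).of_isOpen hU h0U
  have hF0 : F 0 = 0 := by
    rw [← hFf] at hf
    exact hf
  have hF' : fderiv ℂ F 0 ≠ 0 := by
    rw [← hFf] at hf'
    exact hf'
  have hFG : ∀ q, RegularAt Set.univ q 0 → ¬ ∀ᶠ x in zariskiNhds n, G x = F x * q x := by
    intro q hq H
    refine hfg ⟨⟨(q : Germ (zariskiNhds n) ℂ), q, hq, rfl⟩, Subtype.ext ?_⟩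
    rw [Subring.coe_mul, ← hFf, ← hGg]
    exact Germ.coe_eq.2 H
  by_cases hG0 : G 0 = 0
  swap
  · exact germIso_localBlowup_of_ne_zero hU h0U hFr hGr hF0 hG0
  obtain ⟨P, Q, hQ0, hPQ⟩ := regularAt_zero_iff.1 hFr
  obtain ⟨h, Q', hQ'0, hhQ'⟩ := regularAt_zero_iff.1 hGr
  have hpoly : ∀ q : MvPolynomial (Fin n) ℂ,
      RegularAt Set.univ (fun x => MvPolynomial.eval x q) (0 : Fin n → ℂ) :=
    fun q => RegularAt.eval (fun i => regularAt_apply i) q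
  have hP0 : MvPolynomial.eval 0 P = 0 := by
    have := (hPQ.filter_mono (nhds_le_zariskiNhds n)).self_of_nhds.2
    rw [hF0, eq_comm, div_eq_zero_iff] at this
    exact this.resolve_right hQ0
  have hh0 : MvPolynomial.eval 0 h = 0 := by
    have := (hhQ'.filter_mono (nhds_le_zariskiNhds n)).self_of_nhds.2
    rw [hG0, eq_comm, div_eq_zero_iff] at this
    exact this.resolve_right hQ'0
  have hPne : P ≠ 0 := by
    rintro rfl
    refine hF' ?_
    have : F =ᶠ[𝓝 0] fun _ => 0 := (hPQ.filter_mono (nhds_le_zariskiNhds n)).mono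
      fun x hx => by rw [hx.2, map_zero, zero_div]
    rw [this.fderiv_eq, fderiv_fun_const]
    rfl
  obtain ⟨p, hp, ⟨Y, rfl⟩, hp0⟩ := exists_prime_dvd_eval_eq_zero hPne hP0
  have hFe : ∀ᶠ x in zariskiNhds n,
      F x = MvPolynomial.eval x Y / MvPolynomial.eval x Q * MvPolynomial.eval x p := by
    filter_upwards [hPQ] with x hx
    rw [hx.2, map_mul]
    ring
  have hfd : ∀ v, fderiv ℂ F 0 v = MvPolynomial.eval 0 Y / MvPolynomial.eval 0 Q *
      fderiv ℂ (fun x => MvPolynomial.eval x p) 0 v := by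
    intro v
    have hFe' : F =ᶠ[𝓝 0] fun x => MvPolynomial.eval x Y / MvPolynomial.eval x Q *
      MvPolynomial.eval x p := hFe.filter_mono (nhds_le_zariskiNhds n)
    have hYQ : DifferentiableAt ℂ
        (fun x => MvPolynomial.eval x Y / MvPolynomial.eval x Q) (0 : Fin n → ℂ) := by
      simp only [div_eq_mul_inv]
      exact (differentiableAt_eval Y 0).fun_mul ((differentiableAt_eval Q 0).fun_inv hQ0)
    rw [hFe'.fderiv_eq, fderiv_fun_mul hYQ (differentiableAt_eval p 0), hp0]
    change MvPolynomial.eval 0 Y / MvPolynomial.eval 0 Q *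
      fderiv ℂ (fun x => MvPolynomial.eval x p) 0 v + 0 * fderiv ℂ (fun x =>
        MvPolynomial.eval x Y / MvPolynomial.eval x Q) 0 v = _
    rw [zero_mul, add_zero]
  have hY0 : MvPolynomial.eval 0 Y ≠ 0 := fun h0 => hF' (ContinuousLinearMap.ext fun v => by
    rw [hfd, h0, zero_div, zero_mul, zero_apply])
  refine germIso_localBlowup_of_prime hU h0U hGr hFG ((hpoly Y).div (hpoly Q) trivial hQ0)
    ((regularAt_const 1).div (hpoly Q') trivial hQ'0) (div_ne_zero hY0 hQ0)
    (one_div_ne_zero hQ'0) hFe ?_ hp hp0 hh0 fun h0 => hF' (ContinuousLinearMap.ext fun v => by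
      rw [hfd, h0, zero_apply, mul_zero])
  filter_upwards [hhQ'] with x hx
  rw [hx.2]
  ring
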